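/- Let $N\ge 2$ be an integer and let $\mathcal B$ be an additive category. An $N$-complex $X=(X,d_X)$ over $\mathcal B$ consists of objects $X^i$ and morphisms $d_X^i:X^i\to X^{i+1}$ ($i\in\mathbb Z$) of $\mathcal B$ such that $d_X^{i+N-1}\cdots d_X^{i+1}d_X^{i}=0$ for all $i$; a morphism $f:X\to Y$ is a family $f^i:X^i\to Y^i$ with $d_Y^if^i=f^{i+1}d_X^i$. Let $\mathsf C_N(\mathcal B)$ be the category of $N$-complexes, and let $\mathcal S_N(\mathcal B)$ be the class of sequences $X\to Y\to Z$ in $\mathsf C_N(\mathcal B)$ that are split short exact in each degree. Write $d^{\{k\}}$ for a composite of $k$ consecutive differentials ($d^{\{0\}}=1$). A morphism $f:X\to Y$ is null-homotopic if there are $s^i:X^i\to Y^{i-N+1}$ ($i\in\mathbb Z$) with $$f^i=\sum_{j=1}^{N} d_Y^{\{N-j\}}\,s^{i+j-1}\,d_X^{\{j-1\}}\qquad\text{for all } i .$$ The homotopy category $\mathsf K_N(\mathcal B)$ has the same objects as $\mathsf C_N(\mathcal B)$, and its morphisms are the morphisms of $\mathsf C_N(\mathcal B)$ modulo null-homotopic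 ones. For an $N$-complex $Y$ with differential $e$, let $\Sigma Y$ be the $N$-complex with $(\Sigma Y)^m=\bigoplus_{i=m+1}^{m+N-1}Y^i$ whose differential $(\Sigma Y)^m\to(\Sigma Y)^{m+1}$ is $$(y_{m+1},\dots,y_{m+N-1})\mapsto\Bigl(y_{m+2},\dots,y_{m+N-1},\,-\sum_{i=m+1}^{m+N-1}e^{\{m+N-i\}}y_i\Bigr);$$ $\Sigma$ is a functor, acting diagonally on morphisms. For a morphism $f:Y\to X$ of $N$-complexes, the mapping cone $C(f)$ is the $N$-complex with $C(f)^m=X^m\oplus(\Sigma Y)^m$ and differential $$d_{C(f)}^m(x,y)=\bigl(d_X^m x+f^{m+1}y_{m+1},\ d_{\Sigma Y}^m y\bigr),\qquad y=(y_{m+1},\dots,y_{m+N-1}).$$ Let $u_f:X\to C(f)$ and $v_f:C(f)\to\Sigma Y$ be the inclusion and the projection. Theorem. 1. $(\mathsf C_N(\mathcal B),\mathcal S_N(\mathcal B))$ is a Frobenius category: it is an exact category in the sense of Quillen, it has enough (relative) projectives and enough (relative) injectives, and its projective and injective objects coincide. 2. $\mathsf K_N(\mathcal B)$ is a triangulated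 category (including the octahedral axiom), with a triangulated structure whose suspension functor is induced by $\Sigma$ and whose distinguished triangles are exactly the triangles isomorphic in $\mathsf K_N(\mathcal B)$ to $$Y\xrightarrow{\ f\ }X\xrightarrow{\ u_f\ }C(f)\xrightarrow{\ v_f\ }\Sigma Y$$ for a morphism $f:Y\to X$ of $N$-complexes. -/

import Mathlib

open CategoryTheory CategoryTheory.Limits

universe v u

noncomputable section

namespace NCpx

variable {B : Type u} [Category.{v} B]

/-- Given objects `X i` and morphisms `d i : X i ⟶ X (i + 1)`, the composite of the `n`
consecutive morphisms `d i`, `d (i + 1)`, ... from `X i` to `X j`, where `j = i + n`. -/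
def iter (X : ℤ → B) (d : ∀ i, X i ⟶ X (i + 1)) : ∀ (n : ℕ) (i j : ℤ), i + n = j → (X i ⟶ X j)
  | 0, i, j, h => eqToHom (by congr 1; simpa using h)
  | n + 1, i, j, h => d i ≫ iter X d n (i + 1) j (by push_cast at h; omega)

end NCpx

/-- An `N`-complex of objects of `B`: any `N` consecutive differentials compose to zero. -/
structure NComplex (B : Type u) [Category.{v} B] [Preadditive B] (N : ℕ) where
  X : ℤ → B
  d : ∀ i, X i ⟶ X (i + 1)
  d_iter : ∀ i, NCpx.iter X d N i (i + N) rfl = 0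

namespace NComplex

variable {B : Type u} [Category.{v} B] [Preadditive B] {N : ℕ}

/-- A morphism of `N`-complexes. -/
@[ext]
structure Hom (X Y : NComplex B N) where
  f : ∀ i, X.X i ⟶ Y.X i
  comm : ∀ i, f i ≫ Y.d i = X.d i ≫ f (i + 1)

/-- The category of `N`-complexes. -/
instance : Category (NComplex B N) where
  Hom := Hom
  id X := ⟨fun i => 𝟙 (X.X i), fun i => by simp⟩
  comp f g := ⟨fun i => f.f i ≫ g.f i, fun i => by
    rw [Category.assoc, g.comm, ← Category.assoc, f.comm, Category.assoc]⟩
  id_comp f := Hom.ext (by funext i; simp)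
  comp_id f := Hom.ext (by funext i; simp)
  assoc f g h := Hom.ext (by funext i; simp)

@[ext]
lemma hom_ext {X Y : NComplex B N} {f g : X ⟶ Y} (h : ∀ i, f.f i = g.f i) : f = g :=
  Hom.ext (funext h)

@[simp] lemma id_f (X : NComplex B N) (i : ℤ) : Hom.f (𝟙 X) i = 𝟙 (X.X i) := rfl

@[simp] lemma comp_f {X Y Z : NComplex B N} (f : X ⟶ Y) (g : Y ⟶ Z) (i : ℤ) :
    (f ≫ g).f i = f.f i ≫ g.f i := rfl

section Additive

variable (X Y : NComplex B N)

instance : Zero (X ⟶ Y) := ⟨⟨fun _ => 0, fun i => by simp⟩⟩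

instance : Add (X ⟶ Y) :=
  ⟨fun f g => ⟨fun i => f.f i + g.f i, fun i => by
    rw [Preadditive.add_comp, Preadditive.comp_add, f.comm, g.comm]⟩⟩

instance : Neg (X ⟶ Y) :=
  ⟨fun f => ⟨fun i => -f.f i, fun i => by
    rw [Preadditive.neg_comp, Preadditive.comp_neg, f.comm]⟩⟩

variable {X Y}

@[simp] lemma zero_f (i : ℤ) : Hom.f (0 : X ⟶ Y) i = 0 := rfl
@[simp] lemma add_f (f g : X ⟶ Y) (i : ℤ) : (f + g).f i = f.f i + g.f i := rfl
@[simp] lemma neg_f (f : X ⟶ Y) (i : ℤ) : (-f).f i = -f.f i := rfl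

instance : AddCommGroup (X ⟶ Y) where
  add_assoc f g h := hom_ext fun i => by simp [add_assoc]
  zero_add f := hom_ext fun i => by simp
  add_zero f := hom_ext fun i => by simp
  add_comm f g := hom_ext fun i => by simp [add_comm]
  neg_add_cancel f := hom_ext fun i => by simp
  nsmul := nsmulRec
  zsmul := zsmulRec

end Additive

/-- Morphisms of `N`-complexes are added degreewise. -/
instance : Preadditive (NComplex B N) where
  add_comp _ _ _ f g h := hom_ext fun i => by simp
  comp_add _ _ _ f g h := hom_ext fun i => by simp

@[simp] lemma sub_f {X Y : NComplex B N} (f g : X ⟶ Y) (i : ℤ) :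
    (f - g).f i = f.f i - g.f i := by
  rw [sub_eq_add_neg, add_f, neg_f, sub_eq_add_neg]

variable (B N) in
/-- The functor `X ↦ X i` from `N`-complexes to `B`. -/
@[simps]
def eval (i : ℤ) : NComplex B N ⥤ B where
  obj X := X.X i
  map f := f.f i

instance (i : ℤ) : (eval B N i).Additive where

/-- The composite `d^{j-i} : X i ⟶ X j` of the differentials if `i ≤ j` (in particular the
identity if `i = j`); by convention it is zero if `j < i`. -/
def pow (X : NComplex B N) (i j : ℤ) : X.X i ⟶ X.X j :=
  if h : i ≤ j then NCpx.iter X.X X.d (j - i).toNat i j (by omega) else 0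

/-- The entry of an identity matrix: the identity of `X i` if `i = j`, and zero otherwise. -/
def delta (X : NComplex B N) (i j : ℤ) : X.X i ⟶ X.X j :=
  if h : i = j then eqToHom (congrArg X.X h) else 0

@[simp] lemma delta_self (X : NComplex B N) (i : ℤ) : X.delta i i = 𝟙 _ := by simp [delta]

lemma delta_of_ne (X : NComplex B N) {i j : ℤ} (h : i ≠ j) : X.delta i j = 0 := by
  simp [delta, h]

lemma iter_congr (X : NComplex B N) {n n' : ℕ} {i j : ℤ} (h : i + n = j) (hn : n = n') :
    NCpx.iter X.X X.d n i j h = NCpx.iter X.X X.d n' i j (hn ▸ h) := by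
  subst hn; rfl

lemma pow_eq_iter (X : NComplex B N) (n : ℕ) (i j : ℤ) (h : i + n = j) :
    X.pow i j = NCpx.iter X.X X.d n i j h := by
  rw [pow, dif_pos (by omega)]
  exact X.iter_congr _ (by omega)

@[simp] lemma pow_self (X : NComplex B N) (i : ℤ) : X.pow i i = 𝟙 _ := by
  rw [X.pow_eq_iter 0 i i (by simp)]; simp [NCpx.iter]

lemma d_pow (X : NComplex B N) (i j : ℤ) (h : i + 1 ≤ j) :
    X.d i ≫ X.pow (i + 1) j = X.pow i j := by
  obtain ⟨n, hn⟩ := Int.eq_ofNat_of_zero_le (sub_nonneg.2 h)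
  rw [X.pow_eq_iter n (i + 1) j (by omega),
    X.pow_eq_iter (n + 1) i j (by push_cast; omega)]
  rfl

lemma pow_N (X : NComplex B N) (i j : ℤ) (h : i + N = j) : X.pow i j = 0 := by
  subst h
  rw [X.pow_eq_iter N i _ rfl, X.d_iter]

lemma pow_d (X : NComplex B N) (i j : ℤ) (h : i ≤ j) :
    X.pow i j ≫ X.d j = X.pow i (j + 1) := by
  obtain ⟨n, hn⟩ := Int.eq_ofNat_of_zero_le (sub_nonneg.2 h)
  induction n generalizing i with
  | zero =>
    obtain rfl : i = j := by simp at hn; omega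
    rw [pow_self, ← X.d_pow i (i + 1) le_rfl]; simp
  | succ n ih =>
    push_cast at hn
    rw [← X.d_pow i j (by omega), Category.assoc, ih (i + 1) (by omega) (by omega),
      X.d_pow _ _ (by omega)]

lemma comm_pow {X Y : NComplex B N} (f : X ⟶ Y) (i j : ℤ) (h : i ≤ j) :
    f.f i ≫ Y.pow i j = X.pow i j ≫ f.f j := by
  obtain ⟨n, hn⟩ := Int.eq_ofNat_of_zero_le (sub_nonneg.2 h)
  induction n generalizing i with
  | zero =>
    obtain rfl : i = j := by simp at hn; omega
    simp
  | succ n ih =>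
    push_cast at hn
    rw [← X.d_pow i j (by omega), ← Y.d_pow i j (by omega), Category.assoc,
      ← ih (i + 1) (by omega) (by omega), ← Category.assoc, f.comm, Category.assoc]

/-- A morphism `f : X ⟶ Y` of `N`-complexes is null-homotopic if there are morphisms
`s i : X i ⟶ Y (i - N + 1)` such that `f i` is the sum over `1 ≤ j ≤ N` of the composites
`X i ⟶ X (i + j - 1) ⟶ Y (i + j - N) ⟶ Y i` of `d_X^{j-1}`, `s (i + j - 1)` and `d_Y^{N-j}`. -/
def NullHomotopic {X Y : NComplex B N} (f : X ⟶ Y) : Prop :=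
  ∃ s : ∀ i : ℤ, X.X i ⟶ Y.X (i - N + 1), ∀ i : ℤ,
    f.f i = ∑ j ∈ Finset.Icc (1 : ℤ) N,
      X.pow i (i + j - 1) ≫ s (i + j - 1) ≫ Y.pow (i + j - 1 - N + 1) i

lemma NullHomotopic.zero (X Y : NComplex B N) : NullHomotopic (0 : X ⟶ Y) :=
  ⟨fun _ => 0, fun i => by simp⟩

lemma NullHomotopic.add {X Y : NComplex B N} {f g : X ⟶ Y} (hf : NullHomotopic f)
    (hg : NullHomotopic g) : NullHomotopic (f + g) := by
  obtain ⟨s, hs⟩ := hf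
  obtain ⟨t, ht⟩ := hg
  exact ⟨fun i => s i + t i, fun i => by simp [hs, ht, Finset.sum_add_distrib]⟩

lemma NullHomotopic.neg {X Y : NComplex B N} {f : X ⟶ Y} (hf : NullHomotopic f) :
    NullHomotopic (-f) := by
  obtain ⟨s, hs⟩ := hf
  exact ⟨fun i => -s i, fun i => by simp [hs]⟩

lemma NullHomotopic.comp {X Y Z : NComplex B N} {f : X ⟶ Y} (hf : NullHomotopic f)
    (g : Y ⟶ Z) : NullHomotopic (f ≫ g) := by
  obtain ⟨s, hs⟩ := hf
  refine ⟨fun i => s i ≫ g.f _, fun i => ?_⟩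
  rw [comp_f, hs, Preadditive.sum_comp]
  refine Finset.sum_congr rfl fun j hj => ?_
  rw [Finset.mem_Icc] at hj
  simp only [Category.assoc]
  rw [comm_pow g _ _ (by omega)]

lemma NullHomotopic.precomp {X Y Z : NComplex B N} (g : X ⟶ Y) {f : Y ⟶ Z}
    (hf : NullHomotopic f) : NullHomotopic (g ≫ f) := by
  obtain ⟨s, hs⟩ := hf
  refine ⟨fun i => g.f i ≫ s i, fun i => ?_⟩
  rw [comp_f, hs, Preadditive.comp_sum]
  refine Finset.sum_congr rfl fun j hj => ?_
  rw [Finset.mem_Icc] at hj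
  rw [← Category.assoc, comm_pow g _ _ (by omega)]
  simp only [Category.assoc]

end NComplex

section HomotopyCategory

variable (B : Type u) [Category.{v} B] [Preadditive B] (N : ℕ)

/-- Two morphisms of `N`-complexes are homotopic if their difference is null-homotopic. -/
def NComplex.homotopic : HomRel (NComplex B N) := fun _ _ f g => NComplex.NullHomotopic (f - g)

instance : Congruence (NComplex.homotopic B N) where
  equivalence :=
    { refl := fun f => by
        have := NComplex.NullHomotopic.zero (N := N) (B := B)
        simpa [NComplex.homotopic] using this _ _
      symm := fun {f g} h => by simpa [NComplex.homotopic] using NComplex.NullHomotopic.neg h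
      trans := fun {f g k} h h' => by
        simpa [NComplex.homotopic] using NComplex.NullHomotopic.add h h' }
  comp_left := fun f _ _ h => by
    simpa [NComplex.homotopic] using NComplex.NullHomotopic.precomp f h
  comp_right := fun g h => by
    simpa [NComplex.homotopic] using NComplex.NullHomotopic.comp h g

/-- The homotopy category of `N`-complexes: the objects are the `N`-complexes, the morphisms are
the morphisms of `N`-complexes modulo the null-homotopic ones. -/
def NHomotopyCategory : Type (max u v) := CategoryTheory.Quotient (NComplex.homotopic B N)

namespace NHomotopyCategory

instance : Category (NHomotopyCategory B N) :=
  inferInstanceAs <| Category (CategoryTheory.Quotient (NComplex.homotopic B N))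

instance : Preadditive (CategoryTheory.Quotient (NComplex.homotopic B N)) :=
  Quotient.preadditive _ (by
    intro X Y f₁ f₂ g₁ g₂ h h'
    have := NComplex.NullHomotopic.add h h'
    rwa [← add_sub_add_comm] at this)

instance : Preadditive (NHomotopyCategory B N) :=
  inferInstanceAs <| Preadditive (CategoryTheory.Quotient (NComplex.homotopic B N))

/-- The quotient functor from `N`-complexes to the homotopy category. -/
def quotient : NComplex B N ⥤ NHomotopyCategory B N :=
  CategoryTheory.Quotient.functor _

instance : (quotient B N).Additive where

instance [HasZeroObject B] : HasZeroObject (NHomotopyCategory B N) := by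
  let Z : NComplex B N := ⟨fun _ => HasZeroObject.zero' B |>.zero, fun _ => 0, fun i =>
    (isZero_zero B).eq_of_src _ _⟩
  have hZ : 𝟙 Z = 0 := NComplex.hom_ext fun i => (isZero_zero B).eq_of_src _ _
  refine ⟨(quotient B N).obj Z, ?_⟩
  rw [IsZero.iff_id_eq_zero, ← (quotient B N).map_id, hZ, Functor.map_zero]

end NHomotopyCategory

end HomotopyCategory

/-! ### The suspension and the mapping cone -/

namespace NComplex

variable {B : Type u} [Category.{v} B] [Preadditive B] {N : ℕ}

/-- Auxiliary fact for the vanishing of `N`-fold composites of differentials. -/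
lemma iter_proj_eq (Y : NComplex B N) (C : ℤ → B) (D : ∀ m, C m ⟶ C (m + 1))
    (q : ∀ m j, C m ⟶ Y.X j)
    (h₁ : ∀ m j : ℤ, m + 2 ≤ j → j ≤ m + N - 1 → D m ≫ q (m + 1) j = q m j)
    (k : ℕ) (m n j : ℤ) (hn : m + k = n) (hj : n + 1 ≤ j) (hj' : j ≤ m + N - 1) :
    NCpx.iter C D k m n hn ≫ q n j = q m j := by
  induction k generalizing m with
  | zero =>
    obtain rfl : m = n := by simpa using hn
    simp [NCpx.iter]
  | succ k ih =>
    push_cast at hn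
    rw [NCpx.iter, Category.assoc, ih _ _ (by omega), h₁ _ _ (by omega) (by omega)]

/-- Auxiliary fact for the vanishing of `N`-fold composites of differentials. -/
lemma iter_proj_zero (Y : NComplex B N) (C : ℤ → B) (D : ∀ m, C m ⟶ C (m + 1))
    (q : ∀ m j, C m ⟶ Y.X j)
    (h₁ : ∀ m j : ℤ, m + 2 ≤ j → j ≤ m + N - 1 → D m ≫ q (m + 1) j = q m j)
    (h₂ : ∀ m j : ℤ, 2 ≤ N → j = m + N → D m ≫ q (m + 1) j =
      -∑ i ∈ Finset.Icc (m + 1) (m + N - 1), q m i ≫ Y.pow i j)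
    (k : ℕ) (m n j : ℤ) (hn : m + k = n) (hj : m + N + 1 ≤ j) (hj' : j ≤ n + N - 1)
    (hj'' : n + 1 ≤ j) :
    NCpx.iter C D k m n hn ≫ q n j = 0 := by
  have key : ∀ m, 2 ≤ N → D m ≫ D (m + 1) ≫ q (m + 1 + 1) (m + N + 1) = 0 := by
    intro m hN
    have e1 : Finset.Icc (m + 1 + 1) (m + 1 + N - 1) =
        insert (m + N) (Finset.Icc (m + 2) (m + N - 1)) := by
      ext x; simp only [Finset.mem_Icc, Finset.mem_insert]; omega
    have e2 : Finset.Icc (m + 1) (m + N - 1) =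
        insert (m + 1) (Finset.Icc (m + 2) (m + N - 1)) := by
      ext x; simp only [Finset.mem_Icc, Finset.mem_insert]; omega
    have e3 : ∑ i ∈ Finset.Icc (m + 2) (m + N - 1), D m ≫ q (m + 1) i ≫ Y.pow i (m + N + 1) =
        ∑ i ∈ Finset.Icc (m + 2) (m + N - 1), q m i ≫ Y.pow i (m + N + 1) := by
      refine Finset.sum_congr rfl fun i hi => ?_
      rw [Finset.mem_Icc] at hi
      rw [← Category.assoc, h₁ _ _ (by omega) (by omega)]
    have e4 : (D m ≫ q (m + 1) (m + N)) ≫ Y.pow (m + N) (m + N + 1) =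
        -∑ i ∈ Finset.Icc (m + 2) (m + N - 1), q m i ≫ Y.pow i (m + N + 1) := by
      rw [h₂ m _ hN rfl, ← Y.d_pow _ _ le_rfl, pow_self, Category.comp_id, Preadditive.neg_comp,
        Preadditive.sum_comp, e2, Finset.sum_insert (by simp)]
      simp only [Category.assoc]
      rw [Y.pow_d _ _ (by omega), Y.pow_N (m + 1) _ (by omega), comp_zero, zero_add]
      congr 1
      refine Finset.sum_congr rfl fun i hi => ?_
      rw [Finset.mem_Icc] at hi
      rw [Y.pow_d _ _ (by omega)]
    rw [h₂ (m + 1) _ hN (by omega), Preadditive.comp_neg, Preadditive.comp_sum, e1,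
      Finset.sum_insert (by simp), e3, ← Category.assoc, e4]
    simp
  induction k generalizing m with
  | zero => simp at hn; omega
  | succ k ih =>
    push_cast at hn
    rw [NCpx.iter, Category.assoc]
    by_cases h : m + 1 + N + 1 ≤ j
    · rw [ih (m + 1) (by omega) h, comp_zero]
    · obtain rfl : j = m + N + 1 := by omega
      obtain _ | k := k
      · simp at hn; omega
      · push_cast at hn
        rw [NCpx.iter, Category.assoc,
          iter_proj_eq Y C D q h₁ k _ _ _ (by omega) (by omega) (by omega), key m (by omega)]

variable [HasFiniteBiproducts B]

/-- The object `⨁_{i = m+1}^{m+N-1} X i`. -/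
abbrev suspX (X : NComplex B N) (m : ℤ) : B :=
  ⨁ fun i : Finset.Icc (m + 1) (m + N - 1) => X.X i

/-- The differential of the suspension of `X` in degree `m`: the matrix whose entry
`X i ⟶ X j` is `-d^{m+N-i}` if `j = m + N`, and for the other `j` is the identity if `i = j` and
zero if `i ≠ j`. -/
def suspD (X : NComplex B N) (m : ℤ) : X.suspX m ⟶ X.suspX (m + 1) :=
  biproduct.matrix fun i j =>
    if (j : ℤ) = m + N then -X.pow i j else X.delta i j

/-- The projection to the component of index `j`, and zero if there is no such component. -/
def suspProj (X : NComplex B N) (m j : ℤ) : X.suspX m ⟶ X.X j :=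
  if h : j ∈ Finset.Icc (m + 1) (m + N - 1) then
    biproduct.π (fun i : Finset.Icc (m + 1) (m + N - 1) => X.X i) ⟨j, h⟩ else 0

lemma suspD_proj₁ (X : NComplex B N) (m j : ℤ) (h : m + 2 ≤ j) (h' : j ≤ m + N - 1) :
    X.suspD m ≫ X.suspProj (m + 1) j = X.suspProj m j := by
  have hj : j ∈ Finset.Icc (m + 1 + 1) (m + 1 + N - 1) := by rw [Finset.mem_Icc]; omega
  have hj' : j ∈ Finset.Icc (m + 1) (m + N - 1) := by rw [Finset.mem_Icc]; omega
  rw [suspProj, dif_pos hj, suspProj, dif_pos hj', suspD, biproduct.matrix_π]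
  refine biproduct.hom_ext' _ _ fun i => ?_
  rw [biproduct.ι_desc, if_neg (by dsimp only; omega)]
  by_cases hi : i = ⟨j, hj'⟩
  · subst hi; simp
  · rw [biproduct.ι_π_ne _ hi, X.delta_of_ne]
    exact fun h => hi (Subtype.ext h)

lemma suspD_proj₂ (X : NComplex B N) (m j : ℤ) (hN : 2 ≤ N) (hj : j = m + N) :
    X.suspD m ≫ X.suspProj (m + 1) j =
      -∑ i ∈ Finset.Icc (m + 1) (m + N - 1), X.suspProj m i ≫ X.pow i j := by
  have hj' : j ∈ Finset.Icc (m + 1 + 1) (m + 1 + N - 1) := by rw [Finset.mem_Icc]; omega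
  rw [suspProj, dif_pos hj', suspD, biproduct.matrix_π, ← Finset.sum_coe_sort]
  refine biproduct.hom_ext' _ _ fun i => ?_
  rw [biproduct.ι_desc, if_pos hj, Preadditive.comp_neg, Preadditive.comp_sum, Finset.sum_eq_single i]
  · rw [suspProj, dif_pos i.2]; simp
  · intro k _ hk
    rw [suspProj, dif_pos k.2, ← Category.assoc, biproduct.ι_π_ne _ (Ne.symm hk), zero_comp]
  · simp

/-- The suspension of an `N`-complex. -/
def susp (X : NComplex B N) : NComplex B N where
  X := X.suspX
  d := X.suspD
  d_iter m := by
    refine biproduct.hom_ext _ _ fun j => ?_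
    have hj := Finset.mem_Icc.1 j.2
    have := iter_proj_zero X X.suspX X.suspD X.suspProj X.suspD_proj₁ X.suspD_proj₂ N m (m + N) j
      rfl (by omega) (by omega) (by omega)
    rwa [suspProj, dif_pos j.2, ← zero_comp (X := X.suspX m)] at this

variable (B N) in
/-- The suspension functor on `N`-complexes, acting diagonally on morphisms. -/
def suspFunctor : NComplex B N ⥤ NComplex B N where
  obj X := X.susp
  map {X Y} f :=
    { f := fun m => biproduct.map fun i => f.f i
      comm := fun m => by
        refine biproduct.hom_ext' _ _ fun i => biproduct.hom_ext _ _ fun j => ?_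
        have hi := Finset.mem_Icc.1 i.2
        have hj := Finset.mem_Icc.1 j.2
        simp only [susp, suspD, Category.assoc, biproduct.ι_map_assoc, biproduct.map_π,
          biproduct.matrix_π, biproduct.ι_desc, biproduct.ι_matrix_assoc,
          biproduct.lift_π_assoc]
        split_ifs with h
        · rw [Preadditive.comp_neg, Preadditive.neg_comp, comm_pow f _ _ (by omega)]
        · by_cases hij : (i : ℤ) = j
          · obtain ⟨i, _⟩ := i
            obtain ⟨j, _⟩ := j
            dsimp only at hij ⊢
            subst hij
            simp
          · rw [X.delta_of_ne hij, Y.delta_of_ne hij, comp_zero, zero_comp] }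
  map_id X := hom_ext fun m => biproduct.hom_ext' _ _ fun i => by
    simp [susp]
  map_comp {X Y Z} f g := hom_ext fun m => by
    change (biproduct.map fun i => f.f i ≫ g.f i : X.suspX m ⟶ Z.suspX m) =
      (biproduct.map fun i => f.f i : X.suspX m ⟶ Y.suspX m) ≫ biproduct.map fun i => g.f i
    refine biproduct.hom_ext' _ _ fun i => ?_
    rw [biproduct.ι_map, biproduct.ι_map_assoc, biproduct.ι_map, Category.assoc]

section Cone

attribute [local instance] hasBinaryBiproducts_of_finite_biproducts

variable {X Y : NComplex B N} (f : Y ⟶ X)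

/-- The object `X m ⊞ ⨁_{i = m+1}^{m+N-1} Y i`. -/
abbrev coneX (_ : Y ⟶ X) (m : ℤ) : B := X.X m ⊞ Y.suspX m

/-- The component `⨁_{i = m+1}^{m+N-1} Y i ⟶ X (m + 1)` of the differential of the cone of `f`:
it is `f` on `Y (m + 1)`, and zero on the other summands. -/
def coneTwist (m : ℤ) : Y.suspX m ⟶ X.X (m + 1) :=
  biproduct.desc fun i => Y.delta i (m + 1) ≫ f.f (m + 1)

/-- The differential of the cone of `f : Y ⟶ X`: it is the differential of `X` on `X m`, and
the sum of `coneTwist` and of the differential of the suspension on the other summand. -/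
def coneD (m : ℤ) : coneX f m ⟶ coneX f (m + 1) :=
  biprod.desc (X.d m ≫ biprod.inl) (coneTwist f m ≫ biprod.inl + Y.suspD m ≫ biprod.inr)

lemma coneTwist_eq (m : ℤ) : coneTwist f m = Y.suspProj m (m + 1) ≫ f.f (m + 1) := by
  refine biproduct.hom_ext' _ _ fun i => ?_
  have hi := Finset.mem_Icc.1 i.2
  rw [coneTwist, biproduct.ι_desc, suspProj, dif_pos (by rw [Finset.mem_Icc]; omega)]
  by_cases h : (i : ℤ) = m + 1
  · obtain ⟨i, _⟩ := i
    dsimp only at h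
    subst h
    simp
  · rw [Y.delta_of_ne h, biproduct.ι_π_ne_assoc _ (fun h' => h (congrArg Subtype.val h')),
      zero_comp]

lemma coneD_fst (m : ℤ) : coneD f m ≫ biprod.fst =
    biprod.fst ≫ X.d m + (biprod.snd ≫ Y.suspProj m (m + 1)) ≫ f.f (m + 1) := by
  refine biprod.hom_ext' _ _ ?_ ?_ <;> simp [coneD, coneTwist_eq]

lemma coneD_snd (m : ℤ) : coneD f m ≫ biprod.snd = biprod.snd ≫ Y.suspD m := by
  refine biprod.hom_ext' _ _ ?_ ?_ <;> simp [coneD]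

lemma coneD_proj₁ (m j : ℤ) (h : m + 2 ≤ j) (h' : j ≤ m + N - 1) :
    coneD f m ≫ biprod.snd ≫ Y.suspProj (m + 1) j = biprod.snd ≫ Y.suspProj m j := by
  rw [← Category.assoc, coneD_snd, Category.assoc, suspD_proj₁ _ _ _ h h']

lemma coneD_proj₂ (m j : ℤ) (hN : 2 ≤ N) (hj : j = m + N) :
    coneD f m ≫ biprod.snd ≫ Y.suspProj (m + 1) j =
      -∑ i ∈ Finset.Icc (m + 1) (m + N - 1), (biprod.snd ≫ Y.suspProj m i) ≫ Y.pow i j := by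
  rw [← Category.assoc, coneD_snd, Category.assoc, suspD_proj₂ _ _ _ hN hj, Preadditive.comp_neg,
    Preadditive.comp_sum]
  simp only [Category.assoc]

lemma iter_coneD_fst (k : ℕ) (m n : ℤ) (hn : m + k = n) (hk : n + 1 ≤ m + N) :
    NCpx.iter (coneX f) (coneD f) k m n hn ≫ biprod.fst = biprod.fst ≫ X.pow m n +
      ∑ i ∈ Finset.Icc (m + 1) n, (biprod.snd ≫ Y.suspProj m i) ≫ f.f i ≫ X.pow i n := by
  induction k generalizing m with
  | zero =>
    obtain rfl : m = n := by simpa using hn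
    simp [NCpx.iter]
  | succ k ih =>
    push_cast at hn
    have e : Finset.Icc (m + 1) n = insert (m + 1) (Finset.Icc (m + 1 + 1) n) := by
      ext x; simp only [Finset.mem_Icc, Finset.mem_insert]; omega
    have e3 : ∑ i ∈ Finset.Icc (m + 1 + 1) n,
          coneD f m ≫ (biprod.snd ≫ Y.suspProj (m + 1) i) ≫ f.f i ≫ X.pow i n =
        ∑ i ∈ Finset.Icc (m + 1 + 1) n, (biprod.snd ≫ Y.suspProj m i) ≫ f.f i ≫ X.pow i n := by
      refine Finset.sum_congr rfl fun i hi => ?_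
      rw [Finset.mem_Icc] at hi
      rw [← Category.assoc, coneD_proj₁ _ _ _ (by omega) (by omega)]
    rw [NCpx.iter, Category.assoc, ih _ (by omega) (by omega), Preadditive.comp_add,
      ← Category.assoc, coneD_fst, Preadditive.comp_sum, e3, e, Finset.sum_insert (by simp),
      Preadditive.add_comp, Category.assoc, X.d_pow _ _ (by omega), add_assoc]
    simp only [Category.assoc]

/-- The mapping cone of a morphism `f : Y ⟶ X` of `N`-complexes. -/
def cone : NComplex B N where
  X := coneX f
  d := coneD f
  d_iter m := by
    refine biprod.hom_ext _ _ ?_ (biproduct.hom_ext _ _ fun j => ?_)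
    · by_cases hN : 2 ≤ N
      · obtain ⟨k, rfl⟩ : ∃ k, N = k + 1 := ⟨N - 1, by omega⟩
        have e1 : Finset.Icc (m + 1 + 1) (m + (k + 1 : ℕ)) =
            insert (m + (k + 1 : ℕ)) (Finset.Icc (m + 1 + 1) (m + (k + 1 : ℕ) - 1)) := by
          ext x; simp only [Finset.mem_Icc, Finset.mem_insert]; omega
        have e2 : Finset.Icc (m + 1) (m + (k + 1 : ℕ) - 1) =
            insert (m + 1) (Finset.Icc (m + 1 + 1) (m + (k + 1 : ℕ) - 1)) := by
          ext x; simp only [Finset.mem_Icc, Finset.mem_insert]; omega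
        have e3 : ∑ i ∈ Finset.Icc (m + 1 + 1) (m + (k + 1 : ℕ) - 1),
              coneD f m ≫ (biprod.snd ≫ Y.suspProj (m + 1) i) ≫ f.f i ≫
                X.pow i (m + (k + 1 : ℕ)) =
            ∑ i ∈ Finset.Icc (m + 1 + 1) (m + (k + 1 : ℕ) - 1),
              (biprod.snd ≫ Y.suspProj m i) ≫ Y.pow i (m + (k + 1 : ℕ)) ≫ f.f _ := by
          refine Finset.sum_congr rfl fun i hi => ?_
          rw [Finset.mem_Icc] at hi
          rw [← Category.assoc, coneD_proj₁ _ _ _ (by omega) (by omega),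
            comm_pow f _ _ (by omega)]
        have e4 : coneD f m ≫ (biprod.snd ≫ Y.suspProj (m + 1) (m + (k + 1 : ℕ))) ≫
            f.f (m + (k + 1 : ℕ)) ≫ X.pow (m + (k + 1 : ℕ)) (m + (k + 1 : ℕ)) =
              -((biprod.snd ≫ Y.suspProj m (m + 1)) ≫ Y.pow (m + 1) (m + (k + 1 : ℕ)) ≫ f.f _ +
              ∑ i ∈ Finset.Icc (m + 1 + 1) (m + (k + 1 : ℕ) - 1),
                (biprod.snd ≫ Y.suspProj m i) ≫ Y.pow i (m + (k + 1 : ℕ)) ≫ f.f _) := by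
          rw [← Category.assoc, coneD_proj₂ _ _ _ hN rfl, e2, Finset.sum_insert (by simp),
            pow_self, Category.comp_id, Preadditive.neg_comp, Preadditive.add_comp,
            Preadditive.sum_comp]
          simp only [Category.assoc]
        rw [NCpx.iter, Category.assoc, iter_coneD_fst _ _ _ _ (by push_cast; omega)
          (by push_cast; omega), Preadditive.comp_add, ← Category.assoc, coneD_fst,
          Preadditive.add_comp, Category.assoc, X.d_pow _ _ (by push_cast; omega),
          X.pow_N m _ rfl, Preadditive.comp_sum, e1, Finset.sum_insert (by simp), e3, e4,
          Category.assoc, comm_pow f _ _ (by push_cast; omega)]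
        simp
      · obtain rfl | rfl : N = 0 ∨ N = 1 := by omega
        · rw [← Category.comp_id (_ ≫ biprod.fst), ← pow_self, X.pow_N _ _ (by simp), comp_zero,
            zero_comp]
        · have hY : ∀ i, Y.suspProj m i = 0 := fun i => by
            rw [suspProj, dif_neg (by rw [Finset.mem_Icc]; push_cast; omega)]
          have hX : X.d m = 0 := by
            have := X.d_pow m (m + 1) le_rfl
            rwa [X.pow_N m _ (by simp), pow_self, Category.comp_id] at this
          rw [zero_comp, NCpx.iter, NCpx.iter, Category.assoc]
          have h0 : coneD f m = 0 := by
            refine biprod.hom_ext _ _ ?_ (biproduct.hom_ext _ _ fun j => ?_)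
            · rw [coneD_fst, hY, hX]; simp
            · have := Finset.mem_Icc.1 j.2
              push_cast at this
              omega
          rw [h0, zero_comp]
    · have hj := Finset.mem_Icc.1 j.2
      have := iter_proj_zero Y (coneX f) (coneD f) (fun m j => biprod.snd ≫ Y.suspProj m j)
        (coneD_proj₁ f) (coneD_proj₂ f) N m (m + N) j rfl (by omega) (by omega) (by omega)
      rw [suspProj, dif_pos j.2] at this
      rw [Category.assoc, this, zero_comp, zero_comp]

/-- The inclusion `X ⟶ C(f)`. -/
def coneInl : X ⟶ cone f where
  f _ := biprod.inl
  comm m := by simp [cone, coneD]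

/-- The projection `C(f) ⟶ ΣY`. -/
def coneSnd : cone f ⟶ (suspFunctor B N).obj Y where
  f _ := biprod.snd
  comm m := (coneD_snd f m).symm

end Cone

end NComplex

/-! ### Exact and Frobenius categories -/

section Exact

variable {C : Type u} [Category.{v} C] [Preadditive C] (E : ObjectProperty (ShortComplex C))

/-- `i` is an admissible monomorphism (inflation) for the class `E`. -/
def IsInflation {X Y : C} (i : X ⟶ Y) : Prop :=
  ∃ (Z : C) (p : Y ⟶ Z) (w : i ≫ p = 0), E (ShortComplex.mk i p w)

/-- `p` is an admissible epimorphism (deflation) for the class `E`. -/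
def IsDeflation {Y Z : C} (p : Y ⟶ Z) : Prop :=
  ∃ (X : C) (i : X ⟶ Y) (w : i ≫ p = 0), E (ShortComplex.mk i p w)

/-- `C`, with the class `E` of sequences `X ⟶ Y ⟶ Z` as its (admissible) short exact sequences, is
an exact category in the sense of Quillen. -/
structure IsExactCategory : Prop where
  additive : HasFiniteBiproducts C
  isoClosed : E.IsClosedUnderIsomorphisms
  isKernel : ∀ S : ShortComplex C, E S → Nonempty (IsLimit (KernelFork.ofι S.f S.zero))
  isCokernel : ∀ S : ShortComplex C, E S → Nonempty (IsColimit (CokernelCofork.ofπ S.g S.zero))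
  inflation_id : ∀ X : C, IsInflation E (𝟙 X)
  deflation_id : ∀ X : C, IsDeflation E (𝟙 X)
  inflation_comp : ∀ {X Y Z : C} (i : X ⟶ Y) (j : Y ⟶ Z), IsInflation E i → IsInflation E j →
    IsInflation E (i ≫ j)
  deflation_comp : ∀ {X Y Z : C} (p : X ⟶ Y) (q : Y ⟶ Z), IsDeflation E p → IsDeflation E q →
    IsDeflation E (p ≫ q)
  inflation_pushout : ∀ {X Y X' : C} (i : X ⟶ Y) (f : X ⟶ X'), IsInflation E i →
    ∃ (Y' : C) (i' : X' ⟶ Y') (f' : Y ⟶ Y'), IsPushout i f f' i' ∧ IsInflation E i'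
  deflation_pullback : ∀ {Y Z Z' : C} (p : Y ⟶ Z) (f : Z' ⟶ Z), IsDeflation E p →
    ∃ (Y' : C) (p' : Y' ⟶ Z') (f' : Y' ⟶ Y), IsPullback f' p' p f ∧ IsDeflation E p'

/-- `P` is projective relative to `E`. -/
def IsRelProjective (P : C) : Prop :=
  ∀ {Y Z : C} (p : Y ⟶ Z), IsDeflation E p → ∀ g : P ⟶ Z, ∃ h : P ⟶ Y, h ≫ p = g

/-- `I` is injective relative to `E`. -/
def IsRelInjective (I : C) : Prop :=
  ∀ {X Y : C} (i : X ⟶ Y), IsInflation E i → ∀ g : X ⟶ I, ∃ h : Y ⟶ I, i ≫ h = g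

/-- A Frobenius category: an exact category with enough projectives and enough injectives, in
which the projective and the injective objects coincide. -/
structure IsFrobeniusCategory : Prop extends IsExactCategory E where
  enough_projectives : ∀ Z : C, ∃ (P : C) (p : P ⟶ Z), IsRelProjective E P ∧ IsDeflation E p
  enough_injectives : ∀ X : C, ∃ (I : C) (i : X ⟶ I), IsRelInjective E I ∧ IsInflation E i
  projective_iff_injective : ∀ P : C, IsRelProjective E P ↔ IsRelInjective E P

end Exact

/-- The sequences of `N`-complexes that are split short exact in each degree. -/
def NComplex.termwiseSplit (B : Type u) [Category.{v} B] [Preadditive B] (N : ℕ) :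
    ObjectProperty (ShortComplex (NComplex B N)) :=
  fun S => ∀ i : ℤ, Nonempty (S.map (NComplex.eval B N i)).Splitting

section Triangles

variable (B : Type u) [Category.{v} B] [Preadditive B] [HasFiniteBiproducts B] (N : ℕ)
  [HasShift (NHomotopyCategory B N) ℤ]

open Pretriangulated

variable {B N} in
/-- For a morphism `f : Y ⟶ X` of `N`-complexes, the triangle `Y ⟶ X ⟶ C(f) ⟶ Y⟦1⟧` in the homotopy
category, where `ΣY` is identified with the shift `Y⟦1⟧` by means of `e`. -/
def NComplex.coneTriangle
    (e : NComplex.suspFunctor B N ⋙ NHomotopyCategory.quotient B N ≅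
      NHomotopyCategory.quotient B N ⋙ shiftFunctor (NHomotopyCategory B N) (1 : ℤ))
    {X Y : NComplex B N} (f : Y ⟶ X) : Triangle (NHomotopyCategory B N) :=
  Triangle.mk ((NHomotopyCategory.quotient B N).map f)
    ((NHomotopyCategory.quotient B N).map (NComplex.coneInl f))
    ((NHomotopyCategory.quotient B N).map (NComplex.coneSnd f) ≫ e.hom.app Y)

end Triangles

end

/-! The proof rests on the cone of an identity, which is free on both sides over graded objects. A
morphism `W ⟶ cone (𝟙 Y)` amounts to an arbitrary family `W m ⟶ Y m` (`coneIdLift`,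
`cone_id_hom_ext`). A morphism `cone (𝟙 Y) ⟶ W` amounts to an arbitrary family `Y i ⟶ W (i - N + 1)`
(`coneIdDesc`, `exists_eq_coneIdDesc`), and its restriction to `Y` is the homotopy sum of that
family. Hence null-homotopic means factoring through `Y ⟶ cone (𝟙 Y)` (`nullHomotopic_iff`).

Degreewise retractions and sections are enough to extend and lift such families, so the cones of
identities are both relatively injective and relatively projective. Each `Y` embeds in `cone (𝟙 Y)`,
and each `Z` is covered by the cone of the identity of a complex with zero differential. Thus every
relative projective or injective is a retract of such a cone, and the two classes coincide. The
axioms of an exact category reduce to split sequences in `B`, because degreewise kernels, cokernels,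
pushouts and pullbacks carry induced differentials.

For the triangulation, `cone f` is the pushout of `Y ⟶ cone (𝟙 Y)` along `f`. `ConeSystem` isolates
the properties that are needed, and the triangulated axioms follow by diagram chases in the style of
Happel's stable category of a Frobenius category. The suspension becomes an equivalence on the
quotient by a comparison of injective resolutions (`isEquivalence_of_iso`). Rotation is
`exists_iso_cone_u` and the octahedron is `exists_octahedron`.

A shift by `ℤ` needs coherent functors for all integers, not just one equivalence. `ShiftSpectrum`
replaces the category by an equivalent one of sequences, where shifting is mere reindexing, and the
shift is transported back. -/

noncomputable section

attribute [local instance] hasBinaryBiproducts_of_finite_biproducts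

/-! ### Split short exact sequences of an additive category -/

section SplitSequences

variable {B : Type u} [Category.{v} B] [Preadditive B]

/-- The class of split short exact sequences. -/
def splitSeq (B : Type u) [Category.{v} B] [Preadditive B] : ObjectProperty (ShortComplex B) :=
  fun S => Nonempty S.Splitting

lemma IsInflation.comp_splitSeq [HasFiniteBiproducts B] {X Y Z : B} {i : X ⟶ Y} {j : Y ⟶ Z}
    (hi : IsInflation (splitSeq B) i) (hj : IsInflation (splitSeq B) j) :
    IsInflation (splitSeq B) (i ≫ j) := by
  obtain ⟨U, p, w, ⟨⟨r, s, e₁, e₂, e₃⟩⟩⟩ := hi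
  obtain ⟨V, q, w', ⟨⟨r', s', e₁', e₂', e₃'⟩⟩⟩ := hj
  dsimp only at r s e₁ e₂ e₃ r' s' e₁' e₂' e₃'
  have hs : s' ≫ r' = 0 := ShortComplex.Splitting.s_r (S := .mk j q w') ⟨r', s', e₁', e₂', e₃'⟩
  -- The cokernel of the composite is the sum of the two cokernels; the retraction `r'` is what lets
  -- `p` be evaluated on `Z`.
  refine ⟨U ⊞ V, biprod.lift (r' ≫ p) q, ?_, ⟨⟨r' ≫ r, biprod.desc (s ≫ j) s', ?_, ?_, ?_⟩⟩⟩
  · apply biprod.hom_ext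
    · simp [reassoc_of% e₁', w]
    · simp [w']
  · simp [reassoc_of% e₁', e₁]
  · dsimp only
    apply biprod.hom_ext' <;> apply biprod.hom_ext
    · simp [reassoc_of% e₁', e₂]
    · simp [w']
    · simp [reassoc_of% hs]
    · simp [e₂']
  · simp only [biprod.lift_desc, Category.assoc]
    rw [← e₃', ← add_assoc]
    congr 1
    have := r' ≫= e₃ =≫ j
    simpa using this

lemma IsDeflation.comp_splitSeq [HasFiniteBiproducts B] {X Y Z : B} {p : X ⟶ Y} {q : Y ⟶ Z}
    (hp : IsDeflation (splitSeq B) p) (hq : IsDeflation (splitSeq B) q) :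
    IsDeflation (splitSeq B) (p ≫ q) := by
  obtain ⟨U, i, w, ⟨⟨r, s, e₁, e₂, e₃⟩⟩⟩ := hp
  obtain ⟨V, j, w', ⟨⟨r', s', e₁', e₂', e₃'⟩⟩⟩ := hq
  dsimp only at r s e₁ e₂ e₃ r' s' e₁' e₂' e₃'
  have hs : s ≫ r = 0 := ShortComplex.Splitting.s_r (S := .mk i p w) ⟨r, s, e₁, e₂, e₃⟩
  refine ⟨U ⊞ V, biprod.desc i (j ≫ s), ?_, ⟨⟨biprod.lift r (p ≫ r'), s' ≫ s, ?_, ?_, ?_⟩⟩⟩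
  · apply biprod.hom_ext'
    · simp [reassoc_of% w]
    · simp [reassoc_of% e₂, w']
  · dsimp only
    apply biprod.hom_ext' <;> apply biprod.hom_ext
    · simp [e₁]
    · simp [reassoc_of% w]
    · simp [hs]
    · simp [reassoc_of% e₂, e₁']
  · simp [reassoc_of% e₂, e₂']
  · simp only [biprod.lift_desc, Category.assoc]
    rw [← e₃, add_assoc]
    congr 1
    have := p ≫= e₃' =≫ s
    simpa using this

end SplitSequences

/-! ### Iterated differentials and their naturality. -/

/-- Stated for bare sequences, since it serves to prove the vanishing of `N`-fold composites for
complexes still under construction: vanishing is carried along a family that is monic, epic, or part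
of a jointly monic or epic pair. -/
lemma NCpx.iter_naturality {B : Type u} [Category.{v} B] {X Y : ℤ → B} {d : ∀ i, X i ⟶ X (i + 1)} {d' : ∀ i, Y i ⟶ Y (i + 1)}
    (f : ∀ i, X i ⟶ Y i) (hf : ∀ i, f i ≫ d' i = d i ≫ f (i + 1)) (n : ℕ) (i j : ℤ)
    (h : i + n = j) : f i ≫ NCpx.iter Y d' n i j h = NCpx.iter X d n i j h ≫ f j := by
  induction n generalizing i with
  | zero =>
    obtain rfl : i = j := by simpa using h
    simp [NCpx.iter]
  | succ n ih =>
    rw [NCpx.iter, NCpx.iter, ← Category.assoc, hf, Category.assoc, ih, Category.assoc]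

namespace NComplex

variable {B : Type u} [Category.{v} B] [Preadditive B] {N : ℕ}

lemma Hom.comm_assoc {X Y : NComplex B N} (f : X ⟶ Y) (i : ℤ) {Z : B} (h : Y.X (i + 1) ⟶ Z) :
    f.f i ≫ Y.d i ≫ h = X.d i ≫ f.f (i + 1) ≫ h := by
  rw [← Category.assoc, f.comm, Category.assoc]

lemma d_pow_assoc (X : NComplex B N) (i j : ℤ) (h : i + 1 ≤ j) {Z : B} (g : X.X j ⟶ Z) :
    X.d i ≫ X.pow (i + 1) j ≫ g = X.pow i j ≫ g := by
  rw [← Category.assoc, X.d_pow i j h]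

lemma pow_pow (X : NComplex B N) (i j k : ℤ) (h : i ≤ j) (h' : j ≤ k) :
    X.pow i j ≫ X.pow j k = X.pow i k := by
  induction k, h' using Int.leInduction with
  | base => simp
  | succ k hk ih => rw [← X.pow_d j k hk, ← Category.assoc, ih, X.pow_d _ _ (by omega)]

lemma isIso_pow (X : NComplex B N) (i j : ℤ) (h : i = j) : IsIso (X.pow i j) := by
  subst h
  rw [pow_self]
  infer_instance

lemma comp_delta {Y Y' : NComplex B N} (a : Y ⟶ Y') (i j : ℤ) : a.f i ≫ Y'.delta i j = Y.delta i j ≫ a.f j := by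
  by_cases h : i = j
  · subst h; simp
  · rw [delta_of_ne _ h, delta_of_ne _ h, comp_zero, zero_comp]

/-! ### Degreewise split sequences -/

/-- If `V ⟶ Z` is degreewise the projection in a split short exact sequence, then the kernels
form an `N`-complex. -/
def kernelComplex {V Z : NComplex B N} (p : V ⟶ Z) (K : ℤ → B) (k : ∀ m, K m ⟶ V.X m)
    (w : ∀ m, k m ≫ p.f m = 0) (σ : ∀ m, (ShortComplex.mk (k m) (p.f m) (w m)).Splitting) :
    NComplex B N where
  X := K
  d m := k m ≫ V.d m ≫ (σ (m + 1)).r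
  d_iter m := by
    -- The differential of `V` preserves the kernels because `p` commutes with it, so projecting by
    -- the retraction loses nothing.
    have hk : ∀ m, k m ≫ V.d m = (k m ≫ V.d m ≫ (σ (m + 1)).r) ≫ k (m + 1) := fun m => by
      have h : (σ (m + 1)).r ≫ k (m + 1) = _ := (σ (m + 1)).r_f
      rw [Category.assoc, Category.assoc, h]
      simp [← p.comm_assoc, reassoc_of% (w m)]
    have := (σ (m + N)).mono_f
    rw [← cancel_mono (ShortComplex.mk (k (m + N)) (p.f (m + N)) (w (m + N))).f]
    dsimp only
    rw [← NCpx.iter_naturality k hk, V.d_iter, comp_zero, zero_comp]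

/-- If `U ⟶ V` is degreewise the inclusion in a split short exact sequence, then the cokernels
form an `N`-complex. -/
def cokernelComplex {U V : NComplex B N} (i : U ⟶ V) (Q : ℤ → B) (q : ∀ m, V.X m ⟶ Q m)
    (w : ∀ m, i.f m ≫ q m = 0) (σ : ∀ m, (ShortComplex.mk (i.f m) (q m) (w m)).Splitting) :
    NComplex B N where
  X := Q
  d m := (σ m).s ≫ V.d m ≫ q (m + 1)
  d_iter m := by
    have hq : ∀ m, q m ≫ ((σ m).s ≫ V.d m ≫ q (m + 1)) = V.d m ≫ q (m + 1) := fun m => by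
      have h : q m ≫ (σ m).s = _ := (σ m).g_s
      rw [reassoc_of% h]
      simp [reassoc_of% (i.comm m), w]
    have := (σ m).epi_g
    rw [← cancel_epi (ShortComplex.mk (i.f m) (q m) (w m)).g]
    dsimp only
    rw [NCpx.iter_naturality q hq, V.d_iter, comp_zero, zero_comp]

/-- The differential of `V` restricts to whatever kernels are chosen in each degree, so no
compatibility between the splittings is needed. This reduces questions on deflations to the category
`B`. -/
lemma isDeflation_iff {V Z : NComplex B N} (p : V ⟶ Z) :
    IsDeflation (termwiseSplit B N) p ↔ ∀ m, IsDeflation (splitSeq B) (p.f m) := by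
  constructor
  · rintro ⟨U, i, w, h⟩ m
    exact ⟨U.X m, i.f m, by rw [← comp_f, w, zero_f], h m⟩
  · intro h
    choose K k w σ using h
    replace σ := fun m => (σ m).some
    refine ⟨kernelComplex p K k w σ, ⟨k, fun m => ?_⟩, hom_ext w, fun m => ⟨σ m⟩⟩
    have h : (σ (m + 1)).r ≫ k (m + 1) = _ := (σ (m + 1)).r_f
    simp only [kernelComplex]
    rw [Category.assoc, Category.assoc, h]
    simp [← p.comm_assoc, reassoc_of% (w m)]

lemma isInflation_iff {U V : NComplex B N} (i : U ⟶ V) :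
    IsInflation (termwiseSplit B N) i ↔ ∀ m, IsInflation (splitSeq B) (i.f m) := by
  constructor
  · rintro ⟨Q, q, w, h⟩ m
    exact ⟨Q.X m, q.f m, by rw [← comp_f, w, zero_f], h m⟩
  · intro h
    choose Q q w σ using h
    replace σ := fun m => (σ m).some
    refine ⟨cokernelComplex i Q q w σ, ⟨q, fun m => ?_⟩, hom_ext w, fun m => ⟨σ m⟩⟩
    have h : q m ≫ (σ m).s = _ := (σ m).g_s
    simp only [cokernelComplex]
    rw [reassoc_of% h]
    simp [reassoc_of% (i.comm m), w]

instance : (termwiseSplit B N).IsClosedUnderIsomorphisms where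
  of_iso e h m := ⟨(h m).some.ofIso ((eval B N m).mapShortComplex.mapIso e)⟩

variable {S : ShortComplex (NComplex B N)}

lemma termwiseSplit.exists_splitting (hS : termwiseSplit B N S) :
    ∃ (r : ∀ m, S.X₂.X m ⟶ S.X₁.X m) (s : ∀ m, S.X₃.X m ⟶ S.X₂.X m),
      (∀ m, S.f.f m ≫ r m = 𝟙 _) ∧ (∀ m, s m ≫ S.g.f m = 𝟙 _) ∧
      (∀ m, r m ≫ S.f.f m = 𝟙 _ - S.g.f m ≫ s m) ∧ (∀ m, S.g.f m ≫ s m = 𝟙 _ - r m ≫ S.f.f m) ∧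
      ∀ m, s m ≫ r m = 0 :=
  ⟨fun m => (hS m).some.r, fun m => (hS m).some.s, fun m => (hS m).some.f_r,
    fun m => (hS m).some.s_g, fun m => (hS m).some.r_f, fun m => (hS m).some.g_s,
    fun m => (hS m).some.s_r⟩

/-- The retractions `r` need not commute with the differentials, but `k ≫ r` does: this can be
tested after the monomorphism `S.f`, where it becomes `k`. -/
lemma termwiseSplit.exists_lift (hS : termwiseSplit B N S) {W : NComplex B N} (k : W ⟶ S.X₂)
    (hk : k ≫ S.g = 0) : ∃ l : W ⟶ S.X₁, l ≫ S.f = k := by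
  obtain ⟨r, s, h₁, -, h₃, -⟩ := hS.exists_splitting
  have e : ∀ m, k.f m ≫ r m ≫ S.f.f m = k.f m := fun m => by
    have hk' : k.f m ≫ S.g.f m = 0 := by rw [← comp_f, hk, zero_f]
    simp [h₃, reassoc_of% hk']
  refine ⟨⟨fun m => k.f m ≫ r m, fun m => ?_⟩, hom_ext fun m => by simp [e]⟩
  have h : (k.f m ≫ r m) ≫ S.X₁.d m = ((k.f m ≫ r m) ≫ S.X₁.d m) ≫ S.f.f (m + 1) ≫ r (m + 1) := by
    rw [h₁, Category.comp_id]
  rw [h, Category.assoc, ← S.f.comm_assoc, Category.assoc, reassoc_of% (e m), k.comm_assoc]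

lemma termwiseSplit.exists_desc (hS : termwiseSplit B N S) {W : NComplex B N} (k : S.X₂ ⟶ W)
    (hk : S.f ≫ k = 0) : ∃ l : S.X₃ ⟶ W, S.g ≫ l = k := by
  obtain ⟨r, s, -, h₂, -, h₄, -⟩ := hS.exists_splitting
  have e : ∀ m, S.g.f m ≫ s m ≫ k.f m = k.f m := fun m => by
    have hk' : S.f.f m ≫ k.f m = 0 := by rw [← comp_f, hk, zero_f]
    rw [reassoc_of% (h₄ m)]
    simp [hk']
  refine ⟨⟨fun m => s m ≫ k.f m, fun m => ?_⟩, hom_ext fun m => by simp [e]⟩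
  have h : (s m ≫ k.f m) ≫ W.d m = s m ≫ k.f m ≫ W.d m := Category.assoc _ _ _
  rw [h, k.comm, ← e (m + 1), ← S.g.comm_assoc, reassoc_of% (h₂ m), e]

lemma termwiseSplit.mono_f (hS : termwiseSplit B N S) : Mono S.f where
  right_cancellation a b h := hom_ext fun m => by
    have : Mono (S.f.f m) := (hS m).some.mono_f
    rw [← cancel_mono (S.f.f m), ← comp_f, h, comp_f]

lemma termwiseSplit.epi_g (hS : termwiseSplit B N S) : Epi S.g where
  left_cancellation a b h := hom_ext fun m => by
    have : Epi (S.g.f m) := (hS m).some.epi_g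
    rw [← cancel_epi (S.g.f m), ← comp_f, h, comp_f]

/-- A degreewise split sequence is a kernel sequence. -/
def termwiseSplit.isKernel (hS : termwiseSplit B N S) : IsLimit (KernelFork.ofι S.f S.zero) :=
  have := hS.mono_f
  KernelFork.IsLimit.ofι' _ _ fun k hk => ⟨_, (hS.exists_lift k hk).choose_spec⟩

/-- A degreewise split sequence is a cokernel sequence. -/
def termwiseSplit.isCokernel (hS : termwiseSplit B N S) :
    IsColimit (CokernelCofork.ofπ S.g S.zero) :=
  have := hS.epi_g
  CokernelCofork.IsColimit.ofπ' _ _ fun k hk => ⟨_, (hS.exists_desc k hk).choose_spec⟩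

/-! ### Biproducts, pushouts and pullbacks -/

variable [HasFiniteBiproducts B]

/-- The direct sum of two `N`-complexes. -/
def directSum (X Y : NComplex B N) : NComplex B N where
  X m := X.X m ⊞ Y.X m
  d m := biprod.map (X.d m) (Y.d m)
  d_iter m := by
    apply biprod.hom_ext'
    · rw [NCpx.iter_naturality (d := X.d) (fun m => (biprod.inl : X.X m ⟶ X.X m ⊞ Y.X m)) (by simp),
        X.d_iter, zero_comp, comp_zero]
    · rw [NCpx.iter_naturality (d := Y.d) (fun m => (biprod.inr : Y.X m ⟶ X.X m ⊞ Y.X m)) (by simp),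
        Y.d_iter, zero_comp, comp_zero]

instance : HasBinaryBiproducts (NComplex B N) where
  has_binary_biproduct X Y := hasBinaryBiproduct_of_total
    { pt := directSum X Y
      fst := ⟨fun _ => biprod.fst, fun _ => by simp [directSum]⟩
      snd := ⟨fun _ => biprod.snd, fun _ => by simp [directSum]⟩
      inl := ⟨fun _ => biprod.inl, fun _ => by simp [directSum]⟩
      inr := ⟨fun _ => biprod.inr, fun _ => by simp [directSum]⟩
      inl_fst := hom_ext fun _ => biprod.inl_fst
      inl_snd := hom_ext fun _ => biprod.inl_snd
      inr_fst := hom_ext fun _ => biprod.inr_fst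
      inr_snd := hom_ext fun _ => biprod.inr_snd } (hom_ext fun _ => biprod.total)

instance : HasZeroObject (NComplex B N) := by
  let Z : NComplex B N := ⟨fun _ => HasZeroObject.zero' B |>.zero, fun _ => 0, fun i =>
    (isZero_zero B).eq_of_src _ _⟩
  exact ⟨Z, (IsZero.iff_id_eq_zero Z).2 (hom_ext fun i => (isZero_zero B).eq_of_src _ _)⟩

instance : HasFiniteBiproducts (NComplex B N) := by
  have := hasFiniteProducts_of_has_binary_and_terminal (C := NComplex B N)
  exact HasFiniteBiproducts.of_hasFiniteProducts


variable {X Y Z X' Z' : NComplex B N} {i : X ⟶ Y} {p : Y ⟶ Z} {w : i ≫ p = 0}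

/-- The pushout is `X' ⊞ Z` in each degree, with a differential twisted by the off-diagonal part `s
≫ d ≫ r` of the differential of `Y`, pushed along `f`. The maps `a` from `X'` and `b` from `Y` are
jointly epic, so the vanishing of the iterated differential and every uniqueness statement can be
checked after them. -/
lemma termwiseSplit.exists_pushout (h : termwiseSplit B N (.mk i p w)) (f : X ⟶ X') :
    ∃ (Y' : NComplex B N) (i' : X' ⟶ Y') (f' : Y ⟶ Y'),
      IsPushout i f f' i' ∧ IsInflation (termwiseSplit B N) i' := by
  obtain ⟨r, s, h₁, h₂, h₃, h₄, h₅⟩ := h.exists_splitting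
  dsimp only at r s h₁ h₂ h₃ h₄ h₅
  have w' : ∀ m, i.f m ≫ p.f m = 0 := fun m => by rw [← comp_f, w, zero_f]
  let D : ∀ m, X'.X m ⊞ Z.X m ⟶ X'.X (m + 1) ⊞ Z.X (m + 1) := fun m =>
    biprod.desc (X'.d m ≫ biprod.inl)
      (s m ≫ Y.d m ≫ r (m + 1) ≫ f.f (m + 1) ≫ biprod.inl + Z.d m ≫ biprod.inr)
  let a : ∀ m, X'.X m ⟶ X'.X m ⊞ Z.X m := fun m => biprod.inl
  let b : ∀ m, Y.X m ⟶ X'.X m ⊞ Z.X m := fun m => biprod.lift (r m ≫ f.f m) (p.f m)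
  have ha : ∀ m, a m ≫ D m = X'.d m ≫ a (m + 1) := fun m => by simp [a, D]
  have hb : ∀ m, b m ≫ D m = Y.d m ≫ b (m + 1) := fun m => by
    apply biprod.hom_ext
    · simp only [b, D, Category.assoc, biprod.lift_desc, Preadditive.add_comp, Preadditive.comp_add,
        biprod.inl_fst, biprod.inr_fst, biprod.lift_fst, Category.comp_id, comp_zero, add_zero]
      rw [reassoc_of% (h₄ m)]
      simp [← f.comm, i.comm_assoc, reassoc_of% (h₁ (m + 1))]
    · simp [b, D, p.comm]
  have hsb : ∀ m, s m ≫ b m = biprod.inr := fun m => by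
    apply biprod.hom_ext
    · simp [b, reassoc_of% (h₅ m)]
    · simp [b, h₂]
  have hext : ∀ (m : ℤ) {W : B} (g g' : X'.X m ⊞ Z.X m ⟶ W), a m ≫ g = a m ≫ g' →
      b m ≫ g = b m ≫ g' → g = g' := fun m W g g' e₁ e₂ => by
    refine biprod.hom_ext' _ _ e₁ ?_
    rw [← hsb, Category.assoc, e₂, Category.assoc]
  let Y' : NComplex B N :=
    { X := fun m => X'.X m ⊞ Z.X m
      d := D
      d_iter := fun m => by
        apply hext
        · rw [NCpx.iter_naturality a ha, X'.d_iter, zero_comp, comp_zero]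
        · rw [NCpx.iter_naturality b hb, Y.d_iter, zero_comp, comp_zero] }
  let i' : X' ⟶ Y' := ⟨a, ha⟩
  let f' : Y ⟶ Y' := ⟨b, hb⟩
  have sq : i ≫ f' = f ≫ i' := hom_ext fun m => by
    apply biprod.hom_ext
    · simp [i', f', a, b, reassoc_of% (h₁ m)]
    · simp [i', f', a, b, w']
  refine ⟨Y', i', f', ⟨⟨sq⟩, ⟨PushoutCocone.IsColimit.mk _ (fun c => ⟨fun m =>
    biprod.desc (c.inr.f m) (s m ≫ c.inl.f m), fun m => ?_⟩) (fun c => ?_) (fun c => ?_)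
    fun c l hl₁ hl₂ => ?_⟩⟩, ?_⟩
  case refine_1 =>
    have e₁ : ∀ m, a m ≫ biprod.desc (c.inr.f m) (s m ≫ c.inl.f m) = c.inr.f m := by simp [a]
    have e₂ : ∀ m, b m ≫ biprod.desc (c.inr.f m) (s m ≫ c.inl.f m) = c.inl.f m := fun m => by
      have h := congrArg (fun k => Hom.f k m) c.condition
      simp only [comp_f] at h
      simp [b, ← h, reassoc_of% (h₄ m)]
    apply hext
    · rw [← Category.assoc, e₁, c.inr.comm, ← Category.assoc, ha, Category.assoc, e₁]
    · rw [← Category.assoc, e₂, c.inl.comm, ← Category.assoc, hb, Category.assoc, e₂]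
  case refine_2 =>
    refine hom_ext fun m => ?_
    have h := congrArg (fun k => Hom.f k m) c.condition
    simp only [comp_f] at h
    simp [f', b, ← h, reassoc_of% (h₄ m)]
  case refine_3 => exact hom_ext fun m => by simp [i', a]
  case refine_4 =>
    refine hom_ext fun m => hext m _ _ ?_ ?_
    · have h := congrArg (fun k => Hom.f k m) hl₂
      simpa [i', a] using h
    · have h := congrArg (fun k => Hom.f k m) hl₁
      have h' := congrArg (fun k => Hom.f k m) c.condition
      simp only [comp_f] at h h'
      simpa [b, ← h', reassoc_of% (h₄ m)] using h
  · exact (isInflation_iff i').2 fun m => ⟨Z.X m, biprod.snd, biprod.inl_snd,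
      ⟨ShortComplex.Splitting.ofHasBinaryBiproduct _ _⟩⟩

/-- Dual to the pushout: the degrees are `X ⊞ Z'`, with the off-diagonal part of the differential of
`Y` restricted along `f`, and the maps `a` and `b` are jointly monic. -/
lemma termwiseSplit.exists_pullback (h : termwiseSplit B N (.mk i p w)) (f : Z' ⟶ Z) :
    ∃ (Y' : NComplex B N) (p' : Y' ⟶ Z') (f' : Y' ⟶ Y),
      IsPullback f' p' p f ∧ IsDeflation (termwiseSplit B N) p' := by
  obtain ⟨r, s, h₁, h₂, h₃, h₄, h₅⟩ := h.exists_splitting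
  dsimp only at r s h₁ h₂ h₃ h₄ h₅
  have w' : ∀ m, i.f m ≫ p.f m = 0 := fun m => by rw [← comp_f, w, zero_f]
  let D : ∀ m, X.X m ⊞ Z'.X m ⟶ X.X (m + 1) ⊞ Z'.X (m + 1) := fun m =>
    biprod.lift (biprod.fst ≫ X.d m + biprod.snd ≫ f.f m ≫ s m ≫ Y.d m ≫ r (m + 1))
      (biprod.snd ≫ Z'.d m)
  let a : ∀ m, X.X m ⊞ Z'.X m ⟶ Z'.X m := fun m => biprod.snd
  let b : ∀ m, X.X m ⊞ Z'.X m ⟶ Y.X m := fun m => biprod.desc (i.f m) (f.f m ≫ s m)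
  have ha : ∀ m, a m ≫ Z'.d m = D m ≫ a (m + 1) := fun m => by simp [a, D]
  have hb : ∀ m, b m ≫ Y.d m = D m ≫ b (m + 1) := fun m => by
    apply biprod.hom_ext'
    · simp [b, D, i.comm]
    · simp [b, D, h₃, ← p.comm_assoc, reassoc_of% (h₂ m), ← f.comm_assoc]
  have hbr : ∀ m, b m ≫ r m = biprod.fst := fun m => by
    apply biprod.hom_ext'
    · simp [b, h₁]
    · simp [b, h₅]
  have hext : ∀ (m : ℤ) {W : B} (g g' : W ⟶ X.X m ⊞ Z'.X m), g ≫ a m = g' ≫ a m →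
      g ≫ b m = g' ≫ b m → g = g' := fun m W g g' e₁ e₂ => by
    refine biprod.hom_ext _ _ ?_ e₁
    rw [← hbr, reassoc_of% e₂]
  let Y' : NComplex B N :=
    { X := fun m => X.X m ⊞ Z'.X m
      d := D
      d_iter := fun m => by
        apply hext
        · rw [← NCpx.iter_naturality a ha, Z'.d_iter, zero_comp, comp_zero]
        · rw [← NCpx.iter_naturality b hb, Y.d_iter, zero_comp, comp_zero] }
  let p' : Y' ⟶ Z' := ⟨a, ha⟩
  let f' : Y' ⟶ Y := ⟨b, hb⟩
  have sq : f' ≫ p = p' ≫ f := hom_ext fun m => by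
    apply biprod.hom_ext'
    · simp [p', f', a, b, w']
    · simp [p', f', a, b, h₂]
  refine ⟨Y', p', f', ⟨⟨sq⟩, ⟨PullbackCone.IsLimit.mk _ (fun c => ⟨fun m =>
    biprod.lift (c.fst.f m ≫ r m) (c.snd.f m), fun m => ?_⟩) (fun c => ?_) (fun c => ?_)
    fun c l hl₁ hl₂ => ?_⟩⟩, ?_⟩
  case refine_1 =>
    have e₁ : ∀ m, biprod.lift (c.fst.f m ≫ r m) (c.snd.f m) ≫ a m = c.snd.f m := by simp [a]
    have e₂ : ∀ m, biprod.lift (c.fst.f m ≫ r m) (c.snd.f m) ≫ b m = c.fst.f m := fun m => by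
      have h := congrArg (fun k => Hom.f k m) c.condition
      simp only [comp_f] at h
      simp [b, ← reassoc_of% h, h₃]
    apply hext
    · rw [Category.assoc, Category.assoc, e₁, ← c.snd.comm, ← ha, reassoc_of% e₁]
    · rw [Category.assoc, Category.assoc, e₂, ← c.fst.comm, ← hb, reassoc_of% e₂]
  case refine_2 =>
    refine hom_ext fun m => ?_
    have h := congrArg (fun k => Hom.f k m) c.condition
    simp only [comp_f] at h
    simp [f', b, ← reassoc_of% h, h₃]
  case refine_3 => exact hom_ext fun m => by simp [p', a]
  case refine_4 =>
    refine hom_ext fun m => hext m _ _ ?_ ?_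
    · have h := congrArg (fun k => Hom.f k m) hl₂
      simpa [p', a] using h
    · have h := congrArg (fun k => Hom.f k m) hl₁
      have h' := congrArg (fun k => Hom.f k m) c.condition
      simp only [comp_f] at h h'
      simpa [b, ← reassoc_of% h', h₃] using h
  · exact (isDeflation_iff p').2 fun m => ⟨X.X m, biprod.inl, biprod.inl_snd,
      ⟨ShortComplex.Splitting.ofHasBinaryBiproduct _ _⟩⟩

variable (B N) in
/-- The `N`-complexes with the degreewise split sequences form an exact category. -/
theorem isExactCategory_termwiseSplit : IsExactCategory (termwiseSplit B N) where
  additive := inferInstance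
  isoClosed := inferInstance
  isKernel _ hS := ⟨termwiseSplit.isKernel hS⟩
  isCokernel _ hS := ⟨termwiseSplit.isCokernel hS⟩
  inflation_id X := (isInflation_iff _).2 fun m => ⟨HasZeroObject.zero' B |>.zero, 0, by simp,
    ⟨.ofIsIsoOfIsZero _ (by dsimp; infer_instance) (isZero_zero B)⟩⟩
  deflation_id X := (isDeflation_iff _).2 fun m => ⟨HasZeroObject.zero' B |>.zero, 0, by simp,
    ⟨.ofIsZeroOfIsIso _ (isZero_zero B) (by dsimp; infer_instance)⟩⟩
  inflation_comp i j hi hj := (isInflation_iff _).2 fun m =>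
    ((isInflation_iff i).1 hi m).comp_splitSeq ((isInflation_iff j).1 hj m)
  deflation_comp p q hp hq := (isDeflation_iff _).2 fun m =>
    ((isDeflation_iff p).1 hp m).comp_splitSeq ((isDeflation_iff q).1 hq m)
  inflation_pushout := fun _ f ⟨_, _, _, h⟩ => termwiseSplit.exists_pushout h f
  deflation_pullback := fun _ f ⟨_, _, _, h⟩ => termwiseSplit.exists_pullback h f

end NComplex

namespace NComplex

variable {B : Type u} [Category.{v} B] [Preadditive B] {N : ℕ} [HasFiniteBiproducts B]

/-! ### Components of the mapping cone -/

section Components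

variable {X Y : NComplex B N} (f : Y ⟶ X)

/-- The projection of the cone to its component `X m`. -/
def coneFst (m : ℤ) : (cone f).X m ⟶ X.X m := biprod.fst (X := X.X m) (Y := Y.suspX m)

/-- The projection of the cone of `f : Y ⟶ X` to the suspension of `Y`, in degree `m`. -/
def coneSndX (m : ℤ) : (cone f).X m ⟶ Y.suspX m := biprod.snd (X := X.X m) (Y := Y.suspX m)

/-- The inclusion of the suspension of `Y` in the cone of `f : Y ⟶ X`, in degree `m`. -/
def coneInrX (m : ℤ) : Y.suspX m ⟶ (cone f).X m := biprod.inr (X := X.X m) (Y := Y.suspX m)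

@[simp] lemma coneInrX_fst (m : ℤ) : coneInrX f m ≫ coneFst f m = 0 :=
  biprod.inr_fst (X := X.X m) (Y := Y.suspX m)

@[simp] lemma coneInrX_snd (m : ℤ) : coneInrX f m ≫ coneSndX f m = 𝟙 _ :=
  biprod.inr_snd (X := X.X m) (Y := Y.suspX m)

@[simp] lemma coneInl_sndX (m : ℤ) : (coneInl f).f m ≫ coneSndX f m = 0 :=
  biprod.inl_snd (X := X.X m) (Y := Y.suspX m)

/-- The projection of the cone to its component `Y j`, and zero if there is no such component. -/
def coneProj (m j : ℤ) : (cone f).X m ⟶ Y.X j :=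
  coneSndX f m ≫ Y.suspProj m j

/-- The inclusion in the suspension of the component `Y j`, and zero if there is no such
component. -/
def suspIncl (Y : NComplex B N) (m j : ℤ) : Y.X j ⟶ Y.suspX m :=
  if h : j ∈ Finset.Icc (m + 1) (m + N - 1) then
    biproduct.ι (fun i : Finset.Icc (m + 1) (m + N - 1) => Y.X i) ⟨j, h⟩ else 0

/-- The inclusion in the cone of the component `Y j`, and zero if there is no such component. -/
def coneIncl (m j : ℤ) : Y.X j ⟶ (cone f).X m :=
  Y.suspIncl m j ≫ coneInrX f m

variable {f} in
lemma coneX_hom_ext {W : B} {m : ℤ} {g g' : W ⟶ (cone f).X m}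
    (h₁ : g ≫ coneFst f m = g' ≫ coneFst f m)
    (h₂ : ∀ j ∈ Finset.Icc (m + 1) (m + N - 1), g ≫ coneProj f m j = g' ≫ coneProj f m j) :
    g = g' := by
  refine biprod.hom_ext (X := X.X m) (Y := Y.suspX m) _ _ h₁ (biproduct.hom_ext _ _ fun j => ?_)
  have := h₂ j j.2
  rw [coneProj, suspProj, dif_pos j.2] at this
  rw [← Category.assoc, ← Category.assoc] at this
  exact this

lemma cone_d_fst (m : ℤ) : (cone f).d m ≫ coneFst f (m + 1) =
    coneFst f m ≫ X.d m + coneProj f m (m + 1) ≫ f.f (m + 1) :=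
  coneD_fst f m

lemma cone_d_proj₁ (m j : ℤ) (h : m + 2 ≤ j) (h' : j ≤ m + N - 1) :
    (cone f).d m ≫ coneProj f (m + 1) j = coneProj f m j :=
  coneD_proj₁ f m j h h'

lemma cone_d_proj₂ (m j : ℤ) (hN : 2 ≤ N) (hj : j = m + N) :
    (cone f).d m ≫ coneProj f (m + 1) j =
      -∑ i ∈ Finset.Icc (m + 1) (m + N - 1), coneProj f m i ≫ Y.pow i j :=
  coneD_proj₂ f m j hN hj

@[simp] lemma coneInl_fst (m : ℤ) : (coneInl f).f m ≫ coneFst f m = 𝟙 _ :=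
  biprod.inl_fst (X := X.X m) (Y := Y.suspX m)

@[simp] lemma coneInl_proj (m j : ℤ) : (coneInl f).f m ≫ coneProj f m j = 0 :=
  by rw [coneProj, ← Category.assoc, coneInl_sndX, zero_comp]

@[simp] lemma coneIncl_fst (m j : ℤ) : coneIncl f m j ≫ coneFst f m = 0 := by
  rw [coneIncl, Category.assoc, coneInrX_fst, comp_zero]

lemma coneIncl_eq_zero (m j : ℤ) (h : j ∉ Finset.Icc (m + 1) (m + N - 1)) :
    coneIncl f m j = 0 := by
  rw [coneIncl, suspIncl, dif_neg h, zero_comp]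

lemma suspIncl_proj (Y : NComplex B N) (m i j : ℤ) (h : i ∈ Finset.Icc (m + 1) (m + N - 1)) :
    Y.suspIncl m i ≫ Y.suspProj m j = Y.delta i j := by
  rw [suspIncl, suspProj, dif_pos h]
  by_cases hij : i = j
  · subst hij
    rw [dif_pos h]; simp
  · rw [delta_of_ne _ hij]
    split_ifs with h'
    · exact biproduct.ι_π_ne _ fun e => hij (congrArg Subtype.val e)
    · exact comp_zero

lemma coneIncl_proj (m i j : ℤ) (h : i ∈ Finset.Icc (m + 1) (m + N - 1)) :
    coneIncl f m i ≫ coneProj f m j = Y.delta i j := by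
  rw [coneIncl, coneProj, Category.assoc, ← Category.assoc (coneInrX f m), coneInrX_snd,
    Category.id_comp, suspIncl_proj _ _ _ _ h]

lemma coneX_total (m : ℤ) : 𝟙 ((cone f).X m) = coneFst f m ≫ (coneInl f).f m +
    ∑ j ∈ Finset.Icc (m + 1) (m + N - 1), coneProj f m j ≫ coneIncl f m j := by
  apply coneX_hom_ext
  · simp [Preadditive.add_comp, Preadditive.sum_comp]
  · intro j hj
    rw [Preadditive.add_comp, Preadditive.sum_comp, Finset.sum_eq_single j]
    · simp [coneIncl_proj _ _ _ _ hj]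
    · intro i hi hij
      rw [Category.assoc, coneIncl_proj _ _ _ _ hi, delta_of_ne _ hij, comp_zero]
    · exact fun h => absurd hj h

variable {f} in
lemma coneX_hom_ext' {W : B} {m : ℤ} {g g' : (cone f).X m ⟶ W}
    (h₁ : (coneInl f).f m ≫ g = (coneInl f).f m ≫ g')
    (h₂ : ∀ j ∈ Finset.Icc (m + 1) (m + N - 1), coneIncl f m j ≫ g = coneIncl f m j ≫ g') :
    g = g' := by
  rw [← Category.id_comp g, ← Category.id_comp g', coneX_total]
  simp only [Preadditive.add_comp, Preadditive.sum_comp, Category.assoc, h₁]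
  congr 1
  exact Finset.sum_congr rfl fun j hj => by rw [h₂ j hj]

/-- The columns of the differential, where the definition gives its rows. The formula is uniform in
`i`: for `i = m + 1` the summand leaves the window, and `coneIncl f (m + 1) i` is zero by
convention. -/
lemma coneIncl_d (m i : ℤ) (h : i ∈ Finset.Icc (m + 1) (m + N - 1)) :
    coneIncl f m i ≫ (cone f).d m = Y.delta i (m + 1) ≫ f.f (m + 1) ≫ (coneInl f).f (m + 1) +
      coneIncl f (m + 1) i - Y.pow i (m + N) ≫ coneIncl f (m + 1) (m + N) := by
  have hi := Finset.mem_Icc.1 h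
  apply coneX_hom_ext
  · rw [Category.assoc, cone_d_fst]
    simp only [Preadditive.add_comp, Preadditive.sub_comp, Preadditive.comp_add, Category.assoc,
      coneInl_fst, coneIncl_fst, comp_zero, Category.comp_id, sub_zero, add_zero]
    rw [← Category.assoc, ← Category.assoc, coneIncl_fst, coneIncl_proj _ _ _ _ h, zero_comp,
      zero_add]
  · intro j hj
    rw [Finset.mem_Icc] at hj
    simp only [Category.assoc, Preadditive.add_comp, Preadditive.sub_comp, coneInl_proj, comp_zero,
      zero_add]
    rw [coneIncl_proj f (m + 1) (m + N) j (by rw [Finset.mem_Icc]; omega)]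
    obtain hj' | rfl : j ≤ m + N - 1 ∨ j = m + N := by omega
    · rw [cone_d_proj₁ _ _ _ (by omega) hj', coneIncl_proj _ _ _ _ h,
        Y.delta_of_ne (i := m + N) (by omega), comp_zero, sub_zero]
      by_cases hi' : i = m + 1
      · rw [Y.delta_of_ne (by omega), coneIncl_eq_zero _ _ _ (by rw [Finset.mem_Icc]; omega),
          zero_comp]
      · rw [coneIncl_proj f _ _ _ (by rw [Finset.mem_Icc]; omega)]
    · rw [cone_d_proj₂ _ _ _ (by omega) rfl, Preadditive.comp_neg, Preadditive.comp_sum,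
        Finset.sum_eq_single i, ← Category.assoc, coneIncl_proj _ _ _ _ h, delta_self, delta_self,
        Category.id_comp, Category.comp_id]
      · by_cases hi' : i = m + 1
        · rw [coneIncl_eq_zero _ _ _ (by rw [Finset.mem_Icc]; omega), zero_comp, zero_sub]
        · rw [coneIncl_proj f _ _ _ (by rw [Finset.mem_Icc]; omega), Y.delta_of_ne (by omega),
            zero_sub]
      · intro k _ hk
        rw [← Category.assoc, coneIncl_proj _ _ _ _ h, delta_of_ne _ hk.symm, zero_comp]
      · exact fun h' => absurd h h'

/-- The morphism to the cone with given components. -/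
def coneLift {W : B} (m : ℤ) (x : W ⟶ X.X m) (y : ∀ j, W ⟶ Y.X j) : W ⟶ (cone f).X m :=
  x ≫ (coneInl f).f m + ∑ j ∈ Finset.Icc (m + 1) (m + N - 1), y j ≫ coneIncl f m j

@[simp] lemma coneLift_fst {W : B} (m : ℤ) (x : W ⟶ X.X m) (y : ∀ j, W ⟶ Y.X j) :
    coneLift f m x y ≫ coneFst f m = x := by
  simp [coneLift, Preadditive.add_comp, Preadditive.sum_comp]

lemma coneLift_proj {W : B} (m : ℤ) (x : W ⟶ X.X m) (y : ∀ j, W ⟶ Y.X j) (j : ℤ)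
    (hj : j ∈ Finset.Icc (m + 1) (m + N - 1)) :
    coneLift f m x y ≫ coneProj f m j = y j := by
  rw [coneLift, Preadditive.add_comp, Preadditive.sum_comp, Finset.sum_eq_single j]
  · simp [coneIncl_proj _ _ _ _ hj]
  · intro i hi hij
    rw [Category.assoc, coneIncl_proj _ _ _ _ hi, delta_of_ne _ hij, comp_zero]
  · exact fun h => absurd hj h

/-- The morphism from the cone with given components. -/
def coneDesc {W : B} (m : ℤ) (x : X.X m ⟶ W) (y : ∀ j, Y.X j ⟶ W) : (cone f).X m ⟶ W :=
  coneFst f m ≫ x + ∑ j ∈ Finset.Icc (m + 1) (m + N - 1), coneProj f m j ≫ y j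

@[simp] lemma coneInl_desc {W : B} (m : ℤ) (x : X.X m ⟶ W) (y : ∀ j, Y.X j ⟶ W) :
    (coneInl f).f m ≫ coneDesc f m x y = x := by
  simp [coneDesc, Preadditive.comp_add, Preadditive.comp_sum, ← Category.assoc]

lemma coneIncl_desc {W : B} (m : ℤ) (x : X.X m ⟶ W) (y : ∀ j, Y.X j ⟶ W) (j : ℤ)
    (hj : j ∈ Finset.Icc (m + 1) (m + N - 1)) :
    coneIncl f m j ≫ coneDesc f m x y = y j := by
  rw [coneDesc, Preadditive.comp_add, Preadditive.comp_sum, Finset.sum_eq_single j]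
  · rw [← Category.assoc, ← Category.assoc, coneIncl_proj _ _ _ _ hj]; simp
  · intro i hi hij
    rw [← Category.assoc, coneIncl_proj _ _ _ _ hj, delta_of_ne _ hij.symm, zero_comp]
  · exact fun h => absurd hj h

end Components

/-! ### Morphisms to the cone of an identity -/

lemma sum_Icc_sub_int {A : Type*} [AddCommGroup A] (T : ℤ → A) (m n : ℤ) (h : m ≤ n) :
    ∑ i ∈ Finset.Icc (m + 1) n, (T i - T (i - 1)) = T n - T m := by
  induction n, h using Int.leInduction with
  | base => simp
  | succ n hn ih =>
    have e : Finset.Icc (m + 1) (n + 1) = insert (n + 1) (Finset.Icc (m + 1) n) := by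
      ext x; simp only [Finset.mem_Icc, Finset.mem_insert]; omega
    rw [e, Finset.sum_insert (by simp), ih, add_sub_cancel_right]
    abel

section Lift

variable {W Y : NComplex B N}

/-- The component with index `j` in degree `m` of the morphism to the cone of the identity which
corresponds to a family of morphisms. -/
def coneIdLiftComponent (x : ∀ m, W.X m ⟶ Y.X m) (m j : ℤ) : W.X m ⟶ Y.X j :=
  W.pow m j ≫ x j - W.pow m (j - 1) ≫ x (j - 1) ≫ Y.pow (j - 1) j

/-- The morphism to the cone of the identity of `Y` which corresponds to a family of morphisms
`W m ⟶ Y m`. -/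
def coneIdLift (hN : 2 ≤ N) (x : ∀ m, W.X m ⟶ Y.X m) : W ⟶ cone (𝟙 Y) where
  f m := coneLift (𝟙 Y) m (x m) (coneIdLiftComponent x m)
  comm m := by
    apply coneX_hom_ext
    · rw [Category.assoc, cone_d_fst, Category.assoc, coneLift_fst, Preadditive.comp_add,
        ← Category.assoc, ← Category.assoc, coneLift_fst, coneLift_proj _ _ _ _ _
          (by rw [Finset.mem_Icc]; omega), coneIdLiftComponent, show m + 1 - 1 = m by omega,
        ← W.d_pow m (m + 1) le_rfl, ← Y.d_pow m (m + 1) le_rfl]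
      simp
    · intro j hj
      have hj' := Finset.mem_Icc.1 hj
      rw [Category.assoc, Category.assoc, coneLift_proj _ _ _ _ _ hj]
      obtain h | rfl : j ≤ m + N - 1 ∨ j = m + N := by omega
      · rw [cone_d_proj₁ _ _ _ (by omega) h, coneLift_proj _ _ _ _ _ (by rw [Finset.mem_Icc]; omega),
          coneIdLiftComponent, coneIdLiftComponent, Preadditive.comp_sub,
          W.d_pow_assoc _ _ (by omega), W.d_pow_assoc _ _ (by omega)]
      · rw [cone_d_proj₂ _ _ _ hN rfl, Preadditive.comp_neg, Preadditive.comp_sum]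
        have e : ∀ i ∈ Finset.Icc (m + 1) (m + N - 1), coneLift (𝟙 Y) m (x m)
            (coneIdLiftComponent x m) ≫ coneProj (𝟙 Y) m i ≫ Y.pow i (m + N) =
            (fun i => W.pow m i ≫ x i ≫ Y.pow i (m + N)) i -
              (fun i => W.pow m i ≫ x i ≫ Y.pow i (m + N)) (i - 1) := fun i hi => by
          have hi' := Finset.mem_Icc.1 hi
          rw [← Category.assoc, coneLift_proj _ _ _ _ _ hi, coneIdLiftComponent,
            Preadditive.sub_comp]
          simp only [Category.assoc]
          rw [Y.pow_pow _ _ _ (by omega) (by omega)]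
        -- The sum telescopes to its terms at `m + N - 1` and `m`. The latter vanishes by `d^N = 0`
        -- in `Y`, and the former matches the new component, whose other term vanishes by `d^N = 0`
        -- in `W`.
        rw [Finset.sum_congr rfl e, sum_Icc_sub_int _ _ _ (by omega), coneIdLiftComponent,
          Preadditive.comp_sub, W.d_pow_assoc _ _ (by omega), W.d_pow_assoc _ _ (by omega), W.pow_N _ _ rfl, Y.pow_N _ _ rfl]
        simp

@[simp] lemma coneIdLift_fst (hN : 2 ≤ N) (x : ∀ m, W.X m ⟶ Y.X m) (m : ℤ) :
    (coneIdLift hN x).f m ≫ coneFst (𝟙 Y) m = x m :=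
  coneLift_fst _ _ _ _

/-- Compatibility with the differential forces all other components: the row of `Y m` gives the
component `m + 1` in degree `m`, and the shift rows give component `j` in degree `m` from component
`j` in degree `m + 1`. The induction is on `j - (m + 1)`. -/
lemma cone_id_hom_ext {g g' : W ⟶ cone (𝟙 Y)}
    (h : ∀ m, g.f m ≫ coneFst (𝟙 Y) m = g'.f m ≫ coneFst (𝟙 Y) m) : g = g' := by
  suffices H : ∀ (k : ℕ) (m j : ℤ), j = m + 1 + k → j ≤ m + N - 1 →
      g.f m ≫ coneProj (𝟙 Y) m j = g'.f m ≫ coneProj (𝟙 Y) m j from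
    hom_ext fun m => coneX_hom_ext (h m) fun j hj => by
      rw [Finset.mem_Icc] at hj
      exact H (j - (m + 1)).toNat m j (by omega) hj.2
  intro k
  induction k with
  | zero =>
    intro m j hj _
    obtain rfl : j = m + 1 := by simpa using hj
    have e : ∀ l : W ⟶ cone (𝟙 Y), l.f m ≫ coneProj (𝟙 Y) m (m + 1) =
        W.d m ≫ l.f (m + 1) ≫ coneFst (𝟙 Y) (m + 1) - (l.f m ≫ coneFst (𝟙 Y) m) ≫ Y.d m := by
      intro l
      rw [← l.comm_assoc, cone_d_fst]
      simp
    rw [e, e, h, h]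
  | succ k ih =>
    rintro m j hj hj'
    push_cast at hj
    have e : ∀ l : W ⟶ cone (𝟙 Y), l.f m ≫ coneProj (𝟙 Y) m j =
        W.d m ≫ l.f (m + 1) ≫ coneProj (𝟙 Y) (m + 1) j := fun l => by
      rw [← l.comm_assoc, cone_d_proj₁ _ _ _ (by omega) hj']
    rw [e, e, ih _ _ (by omega) (by omega)]

end Lift

end NComplex

/-! ### Criteria for split deflations. -/

section SplitSequences

variable {B : Type u} [Category.{v} B] [Preadditive B]

lemma isDeflation_biproduct_π [HasFiniteBiproducts B] {J : Type} [Finite J] (F : J → B) (j : J) :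
    IsDeflation (splitSeq B) (biproduct.π F j) := by
  classical
  refine ⟨_, biproduct.fromSubtype F (fun i => i ≠ j), ?_,
    ⟨⟨biproduct.toSubtype F _, biproduct.ι F j, ?_, ?_, ?_⟩⟩⟩
  · simp [biproduct.fromSubtype_π]
  · exact biproduct.fromSubtype_toSubtype _ _
  · exact biproduct.ι_π_self _ _
  · dsimp only
    rw [biproduct.toSubtype_fromSubtype]
    refine biproduct.hom_ext' _ _ fun i => ?_
    by_cases h : i = j
    · subst h; simp
    · simp [h, biproduct.ι_π_ne_assoc _ h]

/-- Both `q` and `f` are invertible on the image of `t`, so their kernels are complements of the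
same summand. The kernel of `f` is that of `q`, corrected along `t`. -/
lemma IsDeflation.of_section {A Z Z' : B} {q : A ⟶ Z'} (hq : IsDeflation (splitSeq B) q)
    (t : Z' ⟶ A) (ht : t ≫ q = 𝟙 _) (f : A ⟶ Z) [IsIso (t ≫ f)] :
    IsDeflation (splitSeq B) f := by
  obtain ⟨K, k, w, ⟨⟨r, s, h₁, h₂, h₃⟩⟩⟩ := hq
  dsimp only at r s h₁ h₂ h₃
  have e : t ≫ f ≫ inv (t ≫ f) = 𝟙 _ := by rw [← Category.assoc, IsIso.hom_inv_id]
  have e' : inv (t ≫ f) ≫ t ≫ f = 𝟙 _ := IsIso.inv_hom_id _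
  refine ⟨K, k - k ≫ f ≫ inv (t ≫ f) ≫ t, ?_, ⟨⟨(𝟙 _ - q ≫ t) ≫ r, inv (t ≫ f) ≫ t, ?_, ?_, ?_⟩⟩⟩
  · simp [e']
  · simp [reassoc_of% w, h₁, reassoc_of% ht]
  · simp [e']
  · have h : (𝟙 _ - q ≫ t) ≫ r ≫ k = 𝟙 _ - q ≫ t := by
      have h' : r ≫ k = 𝟙 _ - q ≫ s := by rw [← h₃, add_sub_cancel_right]
      rw [h']
      simp [reassoc_of% ht]
    have h' : ((𝟙 _ - q ≫ t) ≫ r) ≫ (k - k ≫ f ≫ inv (t ≫ f) ≫ t) +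
        f ≫ inv (t ≫ f) ≫ t = 𝟙 A := by
      rw [Category.assoc, Preadditive.comp_sub, Preadditive.comp_sub, h, reassoc_of% h]
      simp [reassoc_of% e]
    exact h'

end SplitSequences

namespace NComplex

variable {B : Type u} [Category.{v} B] [Preadditive B] {N : ℕ}

/-! ### Morphisms from the cone of an identity -/

section Desc

variable {W Y : NComplex B N}

/-- The component with index `i` in degree `m` of the morphism from the cone of the identity which
corresponds to a family of morphisms. -/
def coneIdDescComponent (s : ∀ i : ℤ, Y.X i ⟶ W.X (i - N + 1)) (m i : ℤ) : Y.X i ⟶ W.X m :=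
  ∑ l ∈ Finset.Icc i (m + N - 1), Y.pow i l ≫ s l ≫ W.pow (l - N + 1) m

lemma coneIdDescComponent_d (s : ∀ i : ℤ, Y.X i ⟶ W.X (i - N + 1)) (m i : ℤ) :
    coneIdDescComponent s m i ≫ W.d m =
      ∑ l ∈ Finset.Icc i (m + N - 1), Y.pow i l ≫ s l ≫ W.pow (l - N + 1) (m + 1) := by
  rw [coneIdDescComponent, Preadditive.sum_comp]
  refine Finset.sum_congr rfl fun l hl => ?_
  rw [Finset.mem_Icc] at hl
  rw [Category.assoc, Category.assoc, W.pow_d _ _ (by omega)]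

lemma coneIdDescComponent_d_eq_sub (s : ∀ i : ℤ, Y.X i ⟶ W.X (i - N + 1)) (m i : ℤ)
    (hi : i ≤ m + N) :
    coneIdDescComponent s m i ≫ W.d m = coneIdDescComponent s (m + 1) i -
      Y.pow i (m + N) ≫ coneIdDescComponent s (m + 1) (m + N) := by
  have e : Finset.Icc i (m + 1 + N - 1) = insert (m + N : ℤ) (Finset.Icc i (m + N - 1)) := by
    ext x; simp only [Finset.mem_Icc, Finset.mem_insert]; omega
  have e' : Finset.Icc (m + N : ℤ) (m + 1 + N - 1) = {(m + N : ℤ)} := by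
    ext x; simp only [Finset.mem_Icc, Finset.mem_singleton]; omega
  rw [coneIdDescComponent_d, coneIdDescComponent, coneIdDescComponent, e, e',
    Finset.sum_insert (by simp), Finset.sum_singleton]
  simp

/-- The two sums differ only in the term `l = m` on the left and `l = m + N` on the right, which
vanish by `d^N = 0` in `W` and in `Y`. This is why the homotopy formula defines a morphism of
complexes for any family `s`. -/
lemma coneIdDescComponent_self_d (hN : 2 ≤ N) (s : ∀ i : ℤ, Y.X i ⟶ W.X (i - N + 1)) (m : ℤ) :
    coneIdDescComponent s m m ≫ W.d m = Y.d m ≫ coneIdDescComponent s (m + 1) (m + 1) := by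
  have e : Finset.Icc m (m + N - 1) = insert m (Finset.Icc (m + 1) (m + N - 1)) := by
    ext x; simp only [Finset.mem_Icc, Finset.mem_insert]; omega
  have e' : Finset.Icc (m + 1) (m + 1 + N - 1) =
      insert (m + N : ℤ) (Finset.Icc (m + 1) (m + N - 1)) := by
    ext x; simp only [Finset.mem_Icc, Finset.mem_insert]; omega
  rw [coneIdDescComponent_d, coneIdDescComponent, e, e', Finset.sum_insert (by simp),
    Finset.sum_insert (by simp), Preadditive.comp_add, Preadditive.comp_sum,
    Y.d_pow_assoc _ _ (by omega), Y.pow_N _ _ rfl, W.pow_N _ _ (by omega)]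
  simp only [comp_zero, zero_comp, zero_add]
  refine Finset.sum_congr rfl fun l hl => ?_
  rw [Finset.mem_Icc] at hl
  rw [Y.d_pow_assoc _ _ (by omega)]

variable [HasFiniteBiproducts B]

/-- The morphism from the cone of the identity of `Y` which corresponds to a family of morphisms
`Y i ⟶ W (i - N + 1)`. -/
def coneIdDesc (hN : 2 ≤ N) (s : ∀ i : ℤ, Y.X i ⟶ W.X (i - N + 1)) : cone (𝟙 Y) ⟶ W where
  f m := coneDesc (𝟙 Y) m (coneIdDescComponent s m m) (coneIdDescComponent s m)
  comm m := by
    apply coneX_hom_ext'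
    · rw [← Category.assoc, coneInl_desc, (coneInl (𝟙 Y)).comm_assoc, coneInl_desc,
        coneIdDescComponent_self_d hN]
    · intro i hi
      have hi' := Finset.mem_Icc.1 hi
      rw [← Category.assoc, ← Category.assoc, coneIncl_desc _ _ _ _ _ hi, coneIncl_d _ _ _ hi,
        coneIdDescComponent_d_eq_sub _ _ _ (by omega)]
      simp only [Preadditive.sub_comp, Preadditive.add_comp, Category.assoc, coneInl_desc]
      rw [coneIncl_desc _ _ _ _ (m + N) (by rw [Finset.mem_Icc]; omega)]
      by_cases h : i = m + 1
      · subst h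
        rw [coneIncl_eq_zero _ _ _ (by rw [Finset.mem_Icc]; omega)]
        simp
      · rw [coneIncl_desc _ _ _ _ _ (by rw [Finset.mem_Icc]; omega), delta_of_ne _ h]
        simp

lemma coneInl_coneIdDesc (hN : 2 ≤ N) (s : ∀ i : ℤ, Y.X i ⟶ W.X (i - N + 1)) (m : ℤ) :
    (coneInl (𝟙 Y)).f m ≫ (coneIdDesc hN s).f m = coneIdDescComponent s m m :=
  coneInl_desc _ _ _ _

/-- Only `l = m + N - 1` remains in the sum. The remaining power of the differential of `W` has
length zero; it transports along the equality of indices `m + N - 1 - N + 1 = m`. -/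
lemma coneIncl_coneIdDesc_last (hN : 2 ≤ N) (s : ∀ i : ℤ, Y.X i ⟶ W.X (i - N + 1)) (m : ℤ) :
    coneIncl (𝟙 Y) m (m + N - 1) ≫ (coneIdDesc hN s).f m =
      s (m + N - 1) ≫ W.pow (m + N - 1 - N + 1) m := by
  refine (coneIncl_desc _ _ _ _ _ (by rw [Finset.mem_Icc]; omega)).trans ?_
  simp [coneIdDescComponent]

/-- The last summands generate the cone under the differential: the column formula expresses the
summand `i` in degree `m + 1` by the same summand in degree `m` and the last one in degree `m + 1`.
The base summand `Y (m + 1)` is then reached by applying the differential to the first suspended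
summand in degree `m`. -/
lemma cone_id_hom_ext' (hN : 2 ≤ N) {g g' : cone (𝟙 Y) ⟶ W}
    (h : ∀ m, coneIncl (𝟙 Y) m (m + N - 1) ≫ g.f m = coneIncl (𝟙 Y) m (m + N - 1) ≫ g'.f m) :
    g = g' := by
  have H : ∀ (k : ℕ) (m i : ℤ), i = m + N - 1 - k → m + 1 ≤ i →
      coneIncl (𝟙 Y) m i ≫ g.f m = coneIncl (𝟙 Y) m i ≫ g'.f m := by
    intro k
    induction k with
    | zero =>
      intro m i hi _
      obtain rfl : i = m + N - 1 := by simpa using hi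
      exact h m
    | succ k ih =>
      intro m' i hi hi'
      push_cast at hi
      obtain ⟨m, rfl⟩ : ∃ m, m' = m + 1 := ⟨m' - 1, by omega⟩
      have e : coneIncl (𝟙 Y) (m + 1) i = coneIncl (𝟙 Y) m i ≫ (cone (𝟙 Y)).d m +
          Y.pow i (m + N) ≫ coneIncl (𝟙 Y) (m + 1) (m + N) := by
        rw [coneIncl_d _ _ _ (by rw [Finset.mem_Icc]; omega), Y.delta_of_ne (by omega)]
        simp
      have e' : (m + N : ℤ) = m + 1 + N - 1 := by omega
      have h' : coneIncl (𝟙 Y) (m + 1) (m + N) ≫ g.f (m + 1) =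
          coneIncl (𝟙 Y) (m + 1) (m + N) ≫ g'.f (m + 1) := by
        rw [e']; exact h (m + 1)
      simp only [e, Preadditive.add_comp, Category.assoc, h', ← Hom.comm]
      rw [reassoc_of% (ih m i (by omega) (by omega))]
  have H' : ∀ (m i : ℤ), i ∈ Finset.Icc (m + 1) (m + N - 1) →
      coneIncl (𝟙 Y) m i ≫ g.f m = coneIncl (𝟙 Y) m i ≫ g'.f m := fun m i hi => by
    rw [Finset.mem_Icc] at hi
    exact H (m + N - 1 - i).toNat m i (by omega) (by omega)
  refine hom_ext fun m' => coneX_hom_ext' ?_ (H' m')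
  obtain ⟨m, rfl⟩ : ∃ m, m' = m + 1 := ⟨m' - 1, by omega⟩
  have hm : m + 1 ∈ Finset.Icc (m + 1) (m + N - 1) := by rw [Finset.mem_Icc]; omega
  have e : (coneInl (𝟙 Y)).f (m + 1) = coneIncl (𝟙 Y) m (m + 1) ≫ (cone (𝟙 Y)).d m +
      Y.pow (m + 1) (m + N) ≫ coneIncl (𝟙 Y) (m + 1) (m + N) := by
    rw [coneIncl_d _ _ _ hm, coneIncl_eq_zero _ _ (m + 1) (by rw [Finset.mem_Icc]; omega)]
    simp
  simp only [e, Preadditive.add_comp, Category.assoc, ← Hom.comm]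
  rw [reassoc_of% (H' m _ hm), H' (m + 1) (m + N) (by rw [Finset.mem_Icc]; omega)]

lemma exists_eq_coneIdDesc (hN : 2 ≤ N) (g : cone (𝟙 Y) ⟶ W) : ∃ s, g = coneIdDesc hN s := by
  refine ⟨fun i => coneIncl (𝟙 Y) (i - N + 1) i ≫ g.f (i - N + 1), cone_id_hom_ext' hN fun m => ?_⟩
  -- The degree `m + N - 1 - N + 1` equals `m` only propositionally; a zero-length power absorbs the
  -- transport.
  have key : ∀ m' j, m' = m → coneIncl (𝟙 Y) m j ≫ g.f m =
      (coneIncl (𝟙 Y) m' j ≫ g.f m') ≫ W.pow m' m := by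
    rintro _ j rfl
    simp
  rw [coneIncl_coneIdDesc_last]
  exact key _ _ (by omega)

lemma coneIdDesc_comp (hN : 2 ≤ N) {Z : NComplex B N} (s : ∀ i : ℤ, Y.X i ⟶ W.X (i - N + 1))
    (p : W ⟶ Z) : coneIdDesc hN s ≫ p = coneIdDesc hN fun i => s i ≫ p.f _ :=
  cone_id_hom_ext' hN fun m => by
    rw [comp_f, ← Category.assoc, coneIncl_coneIdDesc_last, coneIncl_coneIdDesc_last,
      Category.assoc, Category.assoc, comm_pow _ _ _ (by omega)]

/-- Every morphism from the cone comes from a family `s`, and its restriction to `Y` is the homotopy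
sum of `s`, reindexed by `l = m + j - 1`. This identifies the homotopy category with the stable
category of the Frobenius structure. -/
lemma nullHomotopic_iff (hN : 2 ≤ N) (f : Y ⟶ W) :
    NullHomotopic f ↔ ∃ h : cone (𝟙 Y) ⟶ W, coneInl (𝟙 Y) ≫ h = f := by
  have key : ∀ (s : ∀ i : ℤ, Y.X i ⟶ W.X (i - N + 1)) (m : ℤ), coneIdDescComponent s m m =
      ∑ j ∈ Finset.Icc (1 : ℤ) N,
        Y.pow m (m + j - 1) ≫ s (m + j - 1) ≫ W.pow (m + j - 1 - N + 1) m := fun s m => by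
    symm
    refine Finset.sum_bij (fun j _ => m + j - 1) ?_ ?_ ?_ (fun _ _ => rfl)
    · intro j hj; rw [Finset.mem_Icc] at hj ⊢; omega
    · intro j _ j' _ h; omega
    · intro l hl
      rw [Finset.mem_Icc] at hl
      exact ⟨l - m + 1, by rw [Finset.mem_Icc]; omega, by omega⟩
  constructor
  · rintro ⟨s, hs⟩
    exact ⟨coneIdDesc hN s, hom_ext fun m => by rw [comp_f, coneInl_coneIdDesc, key, hs]⟩
  · rintro ⟨h, rfl⟩
    obtain ⟨s, rfl⟩ := exists_eq_coneIdDesc hN h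
    exact ⟨s, fun m => by rw [comp_f, coneInl_coneIdDesc, key]⟩

end Desc

variable [HasFiniteBiproducts B]

/-! ### The Frobenius structure -/

/-- Morphisms to this cone are arbitrary degreewise families, so they extend by means of degreewise
retractions. -/
lemma isRelInjective_cone_id (hN : 2 ≤ N) (Y : NComplex B N) :
    IsRelInjective (termwiseSplit B N) (cone (𝟙 Y)) := by
  rintro A A' i ⟨_, _, _, h⟩ g
  obtain ⟨r, s, h₁, -⟩ := termwiseSplit.exists_splitting h
  dsimp only at r h₁
  refine ⟨coneIdLift hN fun m => r m ≫ g.f m ≫ coneFst (𝟙 Y) m, cone_id_hom_ext fun m => ?_⟩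
  rw [comp_f, Category.assoc, coneIdLift_fst, reassoc_of% (h₁ m)]

/-- Morphisms from this cone are arbitrary degreewise families, so they lift by means of degreewise
sections. -/
lemma isRelProjective_cone_id (hN : 2 ≤ N) (Y : NComplex B N) :
    IsRelProjective (termwiseSplit B N) (cone (𝟙 Y)) := by
  rintro V Z p ⟨_, _, _, h⟩ g
  obtain ⟨r, t, -, h₂, -⟩ := termwiseSplit.exists_splitting h
  dsimp only at t h₂
  obtain ⟨s, rfl⟩ := exists_eq_coneIdDesc hN g
  refine ⟨coneIdDesc hN fun i => s i ≫ t _, ?_⟩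
  rw [coneIdDesc_comp]
  simp [h₂]

lemma coneInl_coneSnd {X Y : NComplex B N} (f : Y ⟶ X) : coneInl f ≫ coneSnd f = 0 :=
  hom_ext fun _ => biprod.inl_snd

lemma termwiseSplit_cone {X Y : NComplex B N} (f : Y ⟶ X) :
    termwiseSplit B N (.mk (coneInl f) (coneSnd f) (coneInl_coneSnd f)) :=
  fun _ => ⟨ShortComplex.Splitting.ofHasBinaryBiproduct _ _⟩

/-- The `N`-complex with the objects `Z (i - N + 1)` and zero differentials. -/
def zeroDiff (hN : 2 ≤ N) (Z : NComplex B N) : NComplex B N where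
  X i := Z.X (i - N + 1)
  d _ := 0
  d_iter i := by
    obtain ⟨n, rfl⟩ : ∃ n, N = n + 1 := ⟨N - 1, by omega⟩
    simp [NCpx.iter]

lemma isDeflation_coneProj {X Y : NComplex B N} (f : Y ⟶ X) (m j : ℤ)
    (hj : j ∈ Finset.Icc (m + 1) (m + N - 1)) :
    IsDeflation (splitSeq B) (coneProj f m j) := by
  have h₁ : IsDeflation (splitSeq B) (coneSndX f m) :=
    ⟨X.X m, biprod.inl, biprod.inl_snd, ⟨ShortComplex.Splitting.ofHasBinaryBiproduct _ _⟩⟩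
  rw [coneProj, suspProj, dif_pos hj]
  exact h₁.comp_splitSeq (isDeflation_biproduct_π _ _)

/-- With `Y i = Z (i - N + 1)` and `s` the identity, the last summand of the cone in degree `m` maps
isomorphically to `Z m`, so each degree is a split epimorphism. The differential of `Y` plays no
role for the choice of `s`, hence it is taken to be zero. -/
lemma exists_cone_id_deflation (hN : 2 ≤ N) (Z : NComplex B N) :
    ∃ (Y : NComplex B N) (p : cone (𝟙 Y) ⟶ Z), IsDeflation (termwiseSplit B N) p := by
  let Y := zeroDiff hN Z
  let s : ∀ i, Y.X i ⟶ Z.X (i - N + 1) := fun _ => 𝟙 _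
  refine ⟨Y, coneIdDesc hN s, (isDeflation_iff _).2 fun m => ?_⟩
  have hm : m + N - 1 ∈ Finset.Icc (m + 1) (m + N - 1) := by rw [Finset.mem_Icc]; omega
  have : IsIso (coneIncl (𝟙 Y) m (m + N - 1) ≫ (coneIdDesc hN s).f m) := by
    have := Z.isIso_pow (m + N - 1 - N + 1) m (by omega)
    rw [coneIncl_coneIdDesc_last]
    exact IsIso.comp_isIso' (inferInstanceAs (IsIso (𝟙 _))) this
  exact (isDeflation_coneProj (𝟙 Y) m (m + N - 1) hm).of_section _
    ((coneIncl_proj _ _ _ _ hm).trans (delta_self _ _)) _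

variable (B) in
/-- The `N`-complexes with the degreewise split sequences form a Frobenius category. -/
theorem isFrobeniusCategory_termwiseSplit (hN : 2 ≤ N) :
    IsFrobeniusCategory (termwiseSplit B N) where
  toIsExactCategory := isExactCategory_termwiseSplit B N
  enough_projectives Z := by
    obtain ⟨Y, p, hp⟩ := exists_cone_id_deflation hN Z
    exact ⟨_, p, isRelProjective_cone_id hN Y, hp⟩
  enough_injectives X := ⟨_, coneInl (𝟙 X), isRelInjective_cone_id hN X, _, _, _,
    termwiseSplit_cone (𝟙 X)⟩
  projective_iff_injective P := by
    constructor
    -- A projective `P` is a retract of the cone that covers it, and that cone is injective; the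
    -- converse uses the embedding of `P` in the cone of its identity.
    · intro hP A A' i hi g
      obtain ⟨Y, p, hp⟩ := exists_cone_id_deflation hN P
      obtain ⟨t, ht⟩ := hP p hp (𝟙 P)
      obtain ⟨h, hh⟩ := isRelInjective_cone_id hN Y i hi (g ≫ t)
      exact ⟨h ≫ p, by rw [← Category.assoc, hh, Category.assoc, ht, Category.comp_id]⟩
    · intro hP V Z p hp g
      obtain ⟨r, hr⟩ := hP (coneInl (𝟙 P)) ⟨_, _, _, termwiseSplit_cone (𝟙 P)⟩ (𝟙 P)
      obtain ⟨h, hh⟩ := isRelProjective_cone_id hN P p hp (r ≫ g)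
      exact ⟨coneInl (𝟙 P) ≫ h, by rw [Category.assoc, hh, ← Category.assoc, hr,
        Category.id_comp]⟩

/-! ### Functoriality and universal property of the cone -/

section Functoriality

variable {X Y X' Y' X'' Y'' : NComplex B N}

/-- The morphism of cones induced by a commutative square. -/
def coneMap (f : Y ⟶ X) (f' : Y' ⟶ X') (a : Y ⟶ Y') (b : X ⟶ X') (w : f ≫ b = a ≫ f') :
    cone f ⟶ cone f' where
  f m := coneDesc f m (b.f m ≫ (coneInl f').f m) fun j => a.f j ≫ coneIncl f' m j
  comm m := by
    apply coneX_hom_ext'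
    · rw [← Category.assoc, coneInl_desc, Category.assoc, (coneInl f').comm, b.comm_assoc,
        (coneInl f).comm_assoc, coneInl_desc]
    · intro i hi
      have hi' := Finset.mem_Icc.1 hi
      have w' : f.f (m + 1) ≫ b.f (m + 1) = a.f (m + 1) ≫ f'.f (m + 1) := by
        rw [← comp_f, w, comp_f]
      -- This also covers `i = m + 1`, which is outside the window in degree `m + 1`: both
      -- inclusions are then zero.
      have e : coneIncl f (m + 1) i ≫ coneDesc f (m + 1) (b.f (m + 1) ≫ (coneInl f').f (m + 1))
          (fun j => a.f j ≫ coneIncl f' (m + 1) j) = a.f i ≫ coneIncl f' (m + 1) i := by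
        by_cases h : i ∈ Finset.Icc (m + 1 + 1) (m + 1 + N - 1)
        · exact coneIncl_desc _ _ _ _ _ h
        · rw [coneIncl_eq_zero _ _ _ h, coneIncl_eq_zero _ _ _ h, zero_comp, comp_zero]
      rw [← Category.assoc, ← Category.assoc, coneIncl_desc _ _ _ _ _ hi, coneIncl_d _ _ _ hi,
        Category.assoc, coneIncl_d _ _ _ hi]
      simp only [Preadditive.sub_comp, Preadditive.add_comp, Preadditive.comp_sub,
        Preadditive.comp_add, Category.assoc, coneInl_desc, e]
      rw [coneIncl_desc _ _ _ _ (m + N) (by rw [Finset.mem_Icc]; omega), reassoc_of% w',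
        ← Category.assoc (a.f i), comp_delta, Category.assoc, ← Category.assoc (a.f i) (Y'.pow _ _),
        comm_pow _ _ _ (by omega), Category.assoc]

lemma coneInl_coneMap (f : Y ⟶ X) (f' : Y' ⟶ X') (a : Y ⟶ Y') (b : X ⟶ X')
    (w : f ≫ b = a ≫ f') : coneInl f ≫ coneMap f f' a b w = b ≫ coneInl f' :=
  hom_ext fun _ => coneInl_desc _ _ _ _

lemma coneIncl_coneMap (f : Y ⟶ X) (f' : Y' ⟶ X') (a : Y ⟶ Y') (b : X ⟶ X')
    (w : f ≫ b = a ≫ f') (m j : ℤ) (hj : j ∈ Finset.Icc (m + 1) (m + N - 1)) :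
    coneIncl f m j ≫ (coneMap f f' a b w).f m = a.f j ≫ coneIncl f' m j :=
  coneIncl_desc _ _ _ _ _ hj

lemma cone_hom_ext {f : Y ⟶ X} {W : NComplex B N} {g g' : cone f ⟶ W}
    (h₁ : coneInl f ≫ g = coneInl f ≫ g')
    (h₂ : ∀ m : ℤ, ∀ j ∈ Finset.Icc (m + 1) (m + N - 1),
      coneIncl f m j ≫ g.f m = coneIncl f m j ≫ g'.f m) : g = g' :=
  hom_ext fun m => coneX_hom_ext' (by rw [← comp_f, h₁, comp_f]) (h₂ m)

lemma coneMap_id (f : Y ⟶ X) : coneMap f f (𝟙 Y) (𝟙 X) (by simp) = 𝟙 _ :=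
  cone_hom_ext (by simp [coneInl_coneMap]) fun m j hj => by simp [coneIncl_coneMap _ _ _ _ _ _ _ hj]

lemma coneMap_comp (f : Y ⟶ X) (f' : Y' ⟶ X') (f'' : Y'' ⟶ X'') (a : Y ⟶ Y') (b : X ⟶ X')
    (w : f ≫ b = a ≫ f') (a' : Y' ⟶ Y'') (b' : X' ⟶ X'') (w' : f' ≫ b' = a' ≫ f'') :
    coneMap f f' a b w ≫ coneMap f' f'' a' b' w' =
      coneMap f f'' (a ≫ a') (b ≫ b') (by rw [reassoc_of% w, w', Category.assoc]) :=
  cone_hom_ext (by rw [← Category.assoc, coneInl_coneMap, Category.assoc, coneInl_coneMap,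
      coneInl_coneMap, Category.assoc]) fun m j hj => by
    rw [comp_f, ← Category.assoc, coneIncl_coneMap _ _ _ _ _ _ _ hj,
      coneIncl_coneMap _ _ _ _ _ _ _ hj, Category.assoc, coneIncl_coneMap _ _ _ _ _ _ _ hj, comp_f,
      Category.assoc]

lemma coneIncl_coneSnd (f : Y ⟶ X) (m j : ℤ) :
    coneIncl f m j ≫ (coneSnd f).f m = Y.suspIncl m j := by
  have : coneInrX f m ≫ (coneSnd f).f m = 𝟙 _ := coneInrX_snd f m
  rw [coneIncl, Category.assoc, this]
  exact Category.comp_id _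

lemma suspIncl_suspFunctor_map (a : Y ⟶ Y') (m j : ℤ) :
    Y.suspIncl m j ≫ ((suspFunctor B N).map a).f m = a.f j ≫ Y'.suspIncl m j := by
  rw [suspIncl, suspIncl]
  split_ifs with h
  · exact biproduct.ι_map (fun i : Finset.Icc (m + 1) (m + N - 1) => a.f i) ⟨j, h⟩
  · exact zero_comp.trans comp_zero.symm

lemma coneMap_coneSnd (f : Y ⟶ X) (f' : Y' ⟶ X') (a : Y ⟶ Y') (b : X ⟶ X')
    (w : f ≫ b = a ≫ f') :
    coneMap f f' a b w ≫ coneSnd f' = coneSnd f ≫ (suspFunctor B N).map a :=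
  cone_hom_ext (by rw [← Category.assoc, coneInl_coneMap, Category.assoc, coneInl_coneSnd,
      ← Category.assoc, coneInl_coneSnd, comp_zero, zero_comp]) fun m j hj => by
    rw [comp_f, comp_f, ← Category.assoc, coneIncl_coneMap _ _ _ _ _ _ _ hj, Category.assoc,
      coneIncl_coneSnd, ← Category.assoc, coneIncl_coneSnd]
    exact (suspIncl_suspFunctor_map a m j).symm

variable (B N) in
/-- The functor which sends an `N`-complex to the cone of its identity. -/
def coneIdFunctor : NComplex B N ⥤ NComplex B N where
  obj Y := cone (𝟙 Y)
  map a := coneMap _ _ a a (by simp)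
  map_id Y := coneMap_id _
  map_comp a b := (coneMap_comp _ _ _ _ _ _ _ _ _).symm

/-- The canonical morphism to the cone of `f : Y ⟶ X` from the cone of the identity of `Y`. -/
def coneFromId (f : Y ⟶ X) : cone (𝟙 Y) ⟶ cone f := coneMap _ _ (𝟙 Y) f (by simp)

lemma coneIncl_coneFromId (f : Y ⟶ X) (m j : ℤ) (hj : j ∈ Finset.Icc (m + 1) (m + N - 1)) :
    coneIncl (𝟙 Y) m j ≫ (coneFromId f).f m = coneIncl f m j := by
  rw [coneFromId, coneIncl_coneMap _ _ _ _ _ _ _ hj, id_f, Category.id_comp]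

lemma coneFromId_hom_ext {f : Y ⟶ X} {W : NComplex B N} {g g' : cone f ⟶ W}
    (h₁ : coneInl f ≫ g = coneInl f ≫ g') (h₂ : coneFromId f ≫ g = coneFromId f ≫ g') : g = g' :=
  cone_hom_ext h₁ fun m j hj => by
    rw [← coneIncl_coneFromId _ _ _ hj, Category.assoc, Category.assoc, ← comp_f, h₂, comp_f]

/-- Together with `coneFromId_hom_ext`, this says that `cone f` is the pushout of `Y ⟶ cone (𝟙 Y)`
along `f`, the only description of the cone used in the triangulated axioms. -/
lemma exists_cone_desc (f : Y ⟶ X) {W : NComplex B N} (g : X ⟶ W) (h : cone (𝟙 Y) ⟶ W)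
    (w : coneInl (𝟙 Y) ≫ h = f ≫ g) :
    ∃ l : cone f ⟶ W, coneInl f ≫ l = g ∧ coneFromId f ≫ l = h := by
  let l : cone f ⟶ W :=
    { f := fun m => coneDesc f m (g.f m) fun j => coneIncl (𝟙 Y) m j ≫ h.f m
      comm := fun m => by
        apply coneX_hom_ext'
        · rw [← Category.assoc, coneInl_desc, (coneInl f).comm_assoc, coneInl_desc, g.comm]
        · intro i hi
          have hi' := Finset.mem_Icc.1 hi
          have w' : (coneInl (𝟙 Y)).f (m + 1) ≫ h.f (m + 1) = f.f (m + 1) ≫ g.f (m + 1) := by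
            rw [← comp_f, w, comp_f]
          have e : coneIncl f (m + 1) i ≫ coneDesc f (m + 1) (g.f (m + 1))
              (fun j => coneIncl (𝟙 Y) (m + 1) j ≫ h.f (m + 1)) =
              coneIncl (𝟙 Y) (m + 1) i ≫ h.f (m + 1) := by
            by_cases h' : i ∈ Finset.Icc (m + 1 + 1) (m + 1 + N - 1)
            · exact coneIncl_desc _ _ _ _ _ h'
            · rw [coneIncl_eq_zero _ _ _ h', coneIncl_eq_zero _ _ _ h', zero_comp, zero_comp]
          rw [← Category.assoc, ← Category.assoc, coneIncl_desc _ _ _ _ _ hi, coneIncl_d _ _ _ hi,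
            Category.assoc, h.comm, ← Category.assoc, coneIncl_d _ _ _ hi]
          simp only [Preadditive.sub_comp, Preadditive.add_comp, Category.assoc, coneInl_desc, e]
          rw [coneIncl_desc _ _ _ _ (m + N) (by rw [Finset.mem_Icc]; omega), w', id_f,
            Category.id_comp] }
  have hl : coneInl f ≫ l = g := hom_ext fun m => coneInl_desc _ _ _ _
  refine ⟨l, hl, cone_hom_ext ?_ fun m j hj => ?_⟩
  · rw [coneFromId, ← Category.assoc, coneInl_coneMap, Category.assoc, hl, w]
  · rw [comp_f, ← Category.assoc, coneIncl_coneFromId _ _ _ hj]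
    exact coneIncl_desc _ _ _ _ _ hj

end Functoriality

end NComplex

/-! ### Shifts by integers from a self-equivalence -/

/-- A `ℤ`-indexed sequence of objects, each of which is identified with the image of the previous
one by the functor `F`. -/
structure ShiftSpectrum {C : Type u} [Category.{v} C] (F : C ⥤ C) where
  X : ℤ → C
  φ : ∀ i j : ℤ, i + 1 = j → (F.obj (X i) ≅ X j)

namespace ShiftSpectrum

variable {C : Type u} [Category.{v} C] {F : C ⥤ C}

/-- A morphism of sequences, compatible with the identifications. -/
@[ext]
structure Hom (X Y : ShiftSpectrum F) where
  f : ∀ i, X.X i ⟶ Y.X i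
  comm : ∀ i j h, F.map (f i) ≫ (Y.φ i j h).hom = (X.φ i j h).hom ≫ f j

instance : Category (ShiftSpectrum F) where
  Hom := Hom
  id X := ⟨fun i => 𝟙 _, fun i => by simp⟩
  comp f g := ⟨fun i => f.f i ≫ g.f i, fun i j h => by
    rw [F.map_comp, Category.assoc, g.comm, ← Category.assoc, f.comm, Category.assoc]⟩
  id_comp f := Hom.ext (by funext i; simp)
  comp_id f := Hom.ext (by funext i; simp)
  assoc f g h := Hom.ext (by funext i; simp)

@[ext]
lemma hom_ext {X Y : ShiftSpectrum F} {f g : X ⟶ Y} (h : ∀ i, f.f i = g.f i) : f = g :=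
  Hom.ext (funext h)

@[simp] lemma id_f (X : ShiftSpectrum F) (i : ℤ) : Hom.f (𝟙 X) i = 𝟙 (X.X i) := rfl

@[simp] lemma comp_f {X Y Z : ShiftSpectrum F} (f : X ⟶ Y) (g : Y ⟶ Z) (i : ℤ) :
    (f ≫ g).f i = f.f i ≫ g.f i := rfl

lemma φ_eqToHom (X : ShiftSpectrum F) {i j i' j' : ℤ} (h : i + 1 = j) (h' : i' + 1 = j')
    (e : i = i') (e' : j = j') :
    F.map (eqToHom (congrArg X.X e)) ≫ (X.φ i' j' h').hom =
      (X.φ i j h).hom ≫ eqToHom (congrArg X.X e') := by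
  subst e e'
  simp

/-- Isomorphisms of sequences from compatible isomorphisms in each degree. -/
@[simps]
def isoMk {X Y : ShiftSpectrum F} (e : ∀ i, X.X i ≅ Y.X i)
    (comm : ∀ i j h, F.map (e i).hom ≫ (Y.φ i j h).hom = (X.φ i j h).hom ≫ (e j).hom) : X ≅ Y where
  hom := ⟨fun i => (e i).hom, comm⟩
  inv := ⟨fun i => (e i).inv, fun i j h => by
    rw [← cancel_mono (e j).hom, Category.assoc, ← comm, ← Functor.map_comp_assoc]
    simp⟩

/-- Reindexing of a sequence. -/
@[simps]
def shift (n : ℤ) : ShiftSpectrum F ⥤ ShiftSpectrum F where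
  obj X := ⟨fun i => X.X (i + n), fun i j h => X.φ _ _ (by omega)⟩
  map f := ⟨fun i => f.f (i + n), fun i j h => f.comm _ _ _⟩

@[simp] lemma eqToHom_f {X Y : ShiftSpectrum F} (h : X = Y) (i : ℤ) :
    Hom.f (eqToHom h) i = eqToHom (by rw [h]) := by
  subst h; rfl

lemma Hom.eqToHom_naturality {X Y : ShiftSpectrum F} (f : X ⟶ Y) {i j : ℤ} (h : i = j) :
    f.f i ≫ eqToHom (congrArg Y.X h) = eqToHom (congrArg X.X h) ≫ f.f j := by
  subst h; simp

/-- Reindexing by zero is isomorphic to the identity. -/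
def shiftZero : shift 0 ≅ 𝟭 (ShiftSpectrum F) :=
  NatIso.ofComponents (fun X => isoMk (fun i => eqToIso (congrArg X.X (add_zero i)))
    fun i j h => X.φ_eqToHom _ _ (add_zero i) (add_zero j)) fun f => by
      ext i
      exact Hom.eqToHom_naturality f (add_zero i)

/-- Reindexing by a sum is isomorphic to the composite of the reindexings. -/
def shiftAdd (n m : ℤ) : (shift (n + m) : ShiftSpectrum F ⥤ _) ≅ shift n ⋙ shift m :=
  NatIso.ofComponents (fun X => isoMk (fun i => eqToIso (congrArg X.X (show i + (n + m) = i + m + n by omega)))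
    fun i j h => X.φ_eqToHom _ _ (show i + (n + m) = i + m + n by omega)
      (show j + (n + m) = j + m + n by omega)) fun f => by
      ext i
      exact Hom.eqToHom_naturality f (show i + (n + m) = i + m + n by omega)

lemma shiftZero_inv_app_f (X : ShiftSpectrum F) (i : ℤ) :
    Hom.f (shiftZero.inv.app X) i = eqToHom (congrArg X.X (add_zero i).symm) := rfl

lemma shiftAdd_hom_app_f (n m : ℤ) (X : ShiftSpectrum F) (i : ℤ) :
    Hom.f ((shiftAdd n m).hom.app X) i =
      eqToHom (congrArg X.X (show i + (n + m) = i + m + n by omega)) := rfl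

/-- All comparison maps are transports along equalities of integers, so the coherence conditions
hold automatically. -/
instance : HasShift (ShiftSpectrum F) ℤ := hasShiftMk _ _
  { F := shift
    zero := shiftZero
    add := shiftAdd
    assoc_hom_app := fun a b c X => by
      ext i
      simp only [comp_f, shift_map_f, shiftAdd_hom_app_f, eqToHom_f]
      exact (eqToHom_trans _ _).trans
        ((eqToHom_trans _ _).symm.trans (congrArg _ (eqToHom_trans _ _).symm))
    zero_add_hom_app := fun n X => by
      ext i
      simp only [comp_f, shift_map_f, shiftAdd_hom_app_f, shiftZero_inv_app_f, eqToHom_f]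
      exact (eqToHom_trans _ _).symm
    add_zero_hom_app := fun n X => by
      ext i
      simp only [comp_f, shiftAdd_hom_app_f, shiftZero_inv_app_f, eqToHom_f]
      exact (eqToHom_trans _ _).symm }

variable (F) in
/-- The object in degree zero of a sequence. -/
@[simps]
def eval (n : ℤ) : ShiftSpectrum F ⥤ C where
  obj X := X.X n
  map f := f.f n

/-- The functor `F` relates the evaluations in successive degrees. -/
def evalIso (n m : ℤ) (h : n + 1 = m) : eval F n ⋙ F ≅ eval F m :=
  NatIso.ofComponents (fun X => X.φ n m h) fun f => f.comm _ _ _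

variable [F.IsEquivalence]

/-- Since `F` is faithful and the `φ` are invertible, equality of two morphisms in one degree is
equivalent to equality in the next, and so spreads from degree zero both ways. -/
instance : (eval F 0).Faithful where
  map_injective {X Y f g} h := by
    replace h : f.f 0 = g.f 0 := h
    have H : ∀ i j, i + 1 = j → (f.f i = g.f i ↔ f.f j = g.f j) := fun i j hij => by
      rw [← cancel_epi (X.φ i j hij).hom, ← f.comm, ← g.comm, cancel_mono]
      exact F.map_injective.eq_iff.symm
    ext i
    induction i using Int.induction_on with
    | zero => exact h
    | succ i ih => exact (H _ _ rfl).1 ih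
    | pred i ih => exact (H _ _ (by omega)).2 ih

/-- The extension to nonnegative degrees of a morphism in degree zero. -/
def homNat {X Y : ShiftSpectrum F} (f : X.X 0 ⟶ Y.X 0) : ∀ n : ℕ, X.X n ⟶ Y.X n
  | 0 => f
  | n + 1 => (X.φ n (n + 1 : ℕ) (by simp)).inv ≫ F.map (homNat f n) ≫
      (Y.φ n (n + 1 : ℕ) (by simp)).hom

/-- The extension to nonpositive degrees of a morphism in degree zero. -/
def homNeg {X Y : ShiftSpectrum F} (f : X.X 0 ⟶ Y.X 0) : ∀ n : ℕ, X.X (-n) ⟶ Y.X (-n)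
  | 0 => f
  | n + 1 => F.preimage ((X.φ (-(n + 1 : ℕ)) (-n) (by push_cast; omega)).hom ≫ homNeg f n ≫
      (Y.φ (-(n + 1 : ℕ)) (-n) (by push_cast; omega)).inv)

lemma map_preimage_comp {X Y : C} {X' Y' : C} (a : F.obj X ≅ X') (b : X' ⟶ Y')
    (c : F.obj Y ≅ Y') : F.map (F.preimage (a.hom ≫ b ≫ c.inv)) ≫ c.hom = a.hom ≫ b := by
  simp

instance : (eval F 0).Full where
  map_surjective {X Y} f := by
    let g : ∀ i, X.X i ⟶ Y.X i := fun i => match i with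
      | .ofNat n => homNat f n
      | .negSucc n => homNeg f (n + 1)
    refine ⟨⟨g, ?_⟩, rfl⟩
    rintro i _ rfl
    match i with
    | .ofNat n => exact (Iso.hom_inv_id_assoc (X.φ n (n + 1 : ℕ) (by simp)) _).symm
    | .negSucc 0 => exact map_preimage_comp _ _ _
    | .negSucc (n + 1) => exact map_preimage_comp _ _ _

variable (F) in
/-- The objects of the sequence generated by an object. -/
def orbit (X : C) : ℤ → C
  | .ofNat n => F.obj^[n] X
  | .negSucc n => F.inv.obj^[n + 1] X

variable (F) in
/-- The sequence generated by an object. -/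
def ofObj (X : C) : ShiftSpectrum F where
  X := orbit F X
  φ i _ h := match i with
    | .ofNat n => eqToIso (by subst h; exact (Function.iterate_succ_apply' F.obj n X).symm)
    | .negSucc 0 => F.asEquivalence.counitIso.app X ≪≫ eqToIso (by subst h; rfl)
    | .negSucc (n + 1) => F.mapIso (eqToIso (Function.iterate_succ_apply' F.inv.obj (n + 1) X)) ≪≫
        F.asEquivalence.counitIso.app (F.inv.obj^[n + 1] X) ≪≫ eqToIso (by subst h; rfl)

instance : (eval F 0).EssSurj where
  mem_essImage X := ⟨ofObj F X, ⟨Iso.refl X⟩⟩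

instance : (eval F 0).IsEquivalence where

end ShiftSpectrum

/-- A self-equivalence is isomorphic to the shift by one for some shift by the integers. -/
theorem exists_hasShift_of_isEquivalence {C : Type u} [Category.{v} C] (F : C ⥤ C)
    [F.IsEquivalence] :
    ∃ _ : HasShift C ℤ, Nonempty (F ≅ shiftFunctor C (1 : ℤ)) := by
  let E := (ShiftSpectrum.eval F 0).asEquivalence
  let s : ℤ → C ⥤ C := fun n => E.inverse ⋙ ShiftSpectrum.shift n ⋙ E.functor
  let e : ∀ n, s n ⋙ E.inverse ≅ E.inverse ⋙ shiftFunctor (ShiftSpectrum F) n := fun n =>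
    Functor.isoWhiskerLeft (E.inverse ⋙ ShiftSpectrum.shift n) E.unitIso.symm
  let e' : F ≅ s 1 :=
    Functor.isoWhiskerRight E.counitIso.symm F ≪≫
      Functor.isoWhiskerLeft E.inverse (ShiftSpectrum.evalIso 0 (0 + 1) rfl)
  exact ⟨E.fullyFaithfulInverse.hasShift s e, ⟨e'⟩⟩

/-- If the shift by one is additive, then all shifts are additive. -/
theorem additive_shiftFunctor_of_one {C : Type u} [Category.{v} C] [Preadditive C] [HasShift C ℤ]
    [(shiftFunctor C (1 : ℤ)).Additive] (n : ℤ) : (shiftFunctor C n).Additive := by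
  have : (shiftEquiv C (1 : ℤ)).functor.Additive :=
    inferInstanceAs (shiftFunctor C (1 : ℤ)).Additive
  have h : (shiftFunctor C (-1 : ℤ)).Additive :=
    (inferInstance : (shiftEquiv C (1 : ℤ)).inverse.Additive)
  induction n using Int.induction_on with
  | zero => exact Functor.additive_of_iso (shiftFunctorZero C ℤ).symm
  | succ n ih => exact Functor.additive_of_iso (shiftFunctorAdd C (n : ℤ) 1).symm
  | pred n ih => exact Functor.additive_of_iso (shiftFunctorAdd' C (-n : ℤ) (-1) _ rfl).symm

/-! ### Triangulated quotients of categories with cones -/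

/-- A category with functors `I`, `S`, sequences `A ⟶ I A ⟶ S A` which are kernel and cokernel
sequences, the objects `I A` being both injective and projective with respect to these sequences,
and with pushouts `cone f` of `A ⟶ I A` along the morphisms `f` with source `A`. -/
structure ConeSystem (C : Type u) [Category.{v} C] [Preadditive C] where
  I : C ⥤ C
  S : C ⥤ C
  ι : 𝟭 C ⟶ I
  π : I ⟶ S
  mono_ι (A : C) : Mono (ι.app A)
  epi_π (A : C) : Epi (π.app A)
  ι_π (A : C) : ι.app A ≫ π.app A = 0
  exists_lift {A W : C} (h : W ⟶ I.obj A) (w : h ≫ π.app A = 0) : ∃ l : W ⟶ A, l ≫ ι.app A = h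
  exists_desc {A W : C} (h : I.obj A ⟶ W) (w : ι.app A ≫ h = 0) : ∃ l, π.app A ≫ l = h
  injective {A W : C} (g : A ⟶ I.obj W) : ∃ h, ι.app A ≫ h = g
  projective {A W : C} (g : I.obj W ⟶ S.obj A) : ∃ h, h ≫ π.app A = g
  exists_cover (Z : C) : ∃ (A Y : C) (a : A ⟶ I.obj Y) (p : I.obj Y ⟶ Z), Epi p ∧ a ≫ p = 0 ∧
    (∀ {W : C} (h : I.obj Y ⟶ W), a ≫ h = 0 → ∃ l, p ≫ l = h) ∧
    ∀ {W : C} (g : A ⟶ I.obj W), ∃ h, a ≫ h = g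
  cone {Y X : C} (f : Y ⟶ X) : C
  u {Y X : C} (f : Y ⟶ X) : X ⟶ cone f
  j {Y X : C} (f : Y ⟶ X) : I.obj Y ⟶ cone f
  v {Y X : C} (f : Y ⟶ X) : cone f ⟶ S.obj Y
  ι_j {Y X : C} (f : Y ⟶ X) : ι.app Y ≫ j f = f ≫ u f
  j_v {Y X : C} (f : Y ⟶ X) : j f ≫ v f = π.app Y
  u_v {Y X : C} (f : Y ⟶ X) : u f ≫ v f = 0
  exists_cone_desc {Y X W : C} (f : Y ⟶ X) (g : X ⟶ W) (h : I.obj Y ⟶ W)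
    (w : ι.app Y ≫ h = f ≫ g) : ∃ l, u f ≫ l = g ∧ j f ≫ l = h
  cone_hom_ext {Y X W : C} {f : Y ⟶ X} {l l' : cone f ⟶ W} (h₁ : u f ≫ l = u f ≫ l')
    (h₂ : j f ≫ l = j f ≫ l') : l = l'

namespace ConeSystem

variable {C : Type u} [Category.{v} C] [Preadditive C] (P : ConeSystem C)
  {K : Type*} [Category.{v} K] (Q : C ⥤ K)

lemma ι_naturality {A B : C} (f : A ⟶ B) : P.ι.app A ≫ P.I.map f = f ≫ P.ι.app B :=
  (P.ι.naturality f).symm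

lemma π_naturality {A B : C} (f : A ⟶ B) : P.π.app A ≫ P.S.map f = P.I.map f ≫ P.π.app B :=
  (P.π.naturality f).symm

/-- The functor `Q` is the quotient by the morphisms which factor through `A ⟶ I A`. -/
structure IsStableQuotient [Preadditive K] : Prop where
  additive : Q.Additive
  full : Q.Full
  obj_surjective : Function.Surjective Q.obj
  map_eq_zero_iff {A B : C} (f : A ⟶ B) : Q.map f = 0 ↔ ∃ h, P.ι.app A ≫ h = f

variable {P Q}

lemma map_map_eq {F : K ⥤ K} (i : P.S ⋙ Q ≅ Q ⋙ F) {A B : C} (f : A ⟶ B) :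
    F.map (Q.map f) = i.inv.app A ≫ Q.map (P.S.map f) ≫ i.hom.app B := by
  have := i.hom.naturality f
  dsimp at this
  rw [this, Iso.inv_hom_id_app_assoc]

namespace IsStableQuotient

variable [Preadditive K] (hQ : P.IsStableQuotient Q)

include hQ

/-- By injectivity of `I W`, a morphism that factors through any `I W` also factors through `A ⟶ I
A`. -/
lemma map_comp_eq_zero {A B W : C} (a : A ⟶ P.I.obj W) (b : P.I.obj W ⟶ B) :
    Q.map (a ≫ b) = 0 := by
  obtain ⟨h, hh⟩ := P.injective a
  exact (hQ.map_eq_zero_iff _).2 ⟨h ≫ b, by rw [← Category.assoc, hh]⟩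

lemma map_eq_of_sub_eq {A B W : C} {f g : A ⟶ B} (a : A ⟶ P.I.obj W) (b : P.I.obj W ⟶ B)
    (h : f - g = a ≫ b) : Q.map f = Q.map g := by
  have := hQ.additive
  rw [← sub_eq_zero, ← Q.map_sub, h, hQ.map_comp_eq_zero]

/-! #### The suspension -/

/-- In the quotient, `S f` can be computed from any extension `h` of `f`: the difference of two
extensions kills `A`, so it factors through `S A`, and the two maps induced on suspensions differ by
a map through `I B`. -/
lemma map_S_eq {A B : C} (f : A ⟶ B) (h : P.I.obj A ⟶ P.I.obj B) (g : P.S.obj A ⟶ P.S.obj B)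
    (w₁ : P.ι.app A ≫ h = f ≫ P.ι.app B) (w₂ : h ≫ P.π.app B = P.π.app A ≫ g) :
    Q.map (P.S.map f) = Q.map g := by
  obtain ⟨t, ht⟩ := P.exists_desc (P.I.map f - h) (by
    rw [Preadditive.comp_sub, w₁, P.ι_naturality, sub_self])
  have := P.epi_π A
  refine hQ.map_eq_of_sub_eq t (P.π.app B) ?_
  rw [← cancel_epi (P.π.app A), reassoc_of% ht, Preadditive.sub_comp, w₂, Preadditive.comp_sub,
    P.π_naturality]

lemma map_S_add {A B : C} (f g : A ⟶ B) :
    Q.map (P.S.map (f + g)) = Q.map (P.S.map f) + Q.map (P.S.map g) := by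
  have := hQ.additive
  rw [← Q.map_add]
  exact hQ.map_S_eq _ (P.I.map f + P.I.map g) _
    (by rw [Preadditive.comp_add, P.ι_naturality, P.ι_naturality, Preadditive.add_comp])
    (by rw [Preadditive.add_comp, Preadditive.comp_add, P.π_naturality, P.π_naturality])

/-- If `S f` factors through `I (S A)`, projectivity lifts the second factor to `I B`. Subtracting
the resulting map from `I f` gives a map `I A ⟶ I B` that lands in `B` and still restricts to `f`.
This is faithfulness of the suspension. -/
lemma map_S_eq_zero_iff {A B : C} (f : A ⟶ B) : Q.map (P.S.map f) = 0 ↔ Q.map f = 0 := by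
  have := hQ.additive
  rw [hQ.map_eq_zero_iff f]
  constructor
  · intro h
    obtain ⟨k, hk⟩ := (hQ.map_eq_zero_iff _).1 h
    obtain ⟨k', rfl⟩ := P.projective k
    obtain ⟨l, hl⟩ := P.exists_lift (P.I.map f - P.π.app A ≫ P.ι.app _ ≫ k') (by
      rw [Preadditive.sub_comp, Category.assoc, Category.assoc, hk, P.π_naturality, sub_self])
    have := P.mono_ι B
    refine ⟨l, ?_⟩
    rw [← cancel_mono (P.ι.app B), Category.assoc, hl, Preadditive.comp_sub, P.ι_naturality,
      ← Category.assoc, P.ι_π, zero_comp, sub_zero]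
  · rintro ⟨h, rfl⟩
    rw [hQ.map_S_eq _ (h ≫ P.ι.app B) 0 (by simp) (by simp [P.ι_π]), Q.map_zero]

/-- Fullness of the suspension: lift `g` to the middle terms by projectivity and restrict to the
kernels. -/
lemma exists_map_S_eq {A B : C} (g : P.S.obj A ⟶ P.S.obj B) :
    ∃ f : A ⟶ B, Q.map (P.S.map f) = Q.map g := by
  obtain ⟨h, hh⟩ := P.projective (P.π.app A ≫ g)
  obtain ⟨f, hf⟩ := P.exists_lift (P.ι.app A ≫ h) (by
    rw [Category.assoc, hh, ← Category.assoc, P.ι_π, zero_comp])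
  exact ⟨f, hQ.map_S_eq f h g hf.symm hh⟩

/-- A Schanuel argument: the cover of `Z` with kernel `A` and the sequence `A ⟶ I A ⟶ S A` both
embed `A` in an object `I _`, with respect to which both embeddings have the extension property.
Extending back and forth identifies the cokernels in the quotient. -/
lemma exists_iso_S (Z : C) : ∃ A, Nonempty (Q.obj (P.S.obj A) ≅ Q.obj Z) := by
  obtain ⟨A, Y, a, p, hp, hap, hdesc, hext⟩ := P.exists_cover Z
  obtain ⟨α, hα⟩ := hext (P.ι.app A)
  obtain ⟨β, hβ⟩ := P.injective a
  obtain ⟨z, hz⟩ := hdesc (α ≫ P.π.app A) (by rw [← Category.assoc, hα, P.ι_π])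
  obtain ⟨w, hw⟩ := P.exists_desc (β ≫ p) (by rw [← Category.assoc, hβ, hap])
  obtain ⟨t, ht⟩ := hdesc (α ≫ β - 𝟙 _) (by
    rw [Preadditive.comp_sub, reassoc_of% hα, hβ, Category.comp_id, sub_self])
  obtain ⟨t', ht'⟩ := P.exists_desc (β ≫ α - 𝟙 _) (by
    rw [Preadditive.comp_sub, reassoc_of% hβ, hα, Category.comp_id, sub_self])
  have := P.epi_π A
  refine ⟨A, ⟨⟨Q.map w, Q.map z, ?_, ?_⟩⟩⟩
  · rw [← Q.map_comp, ← Q.map_id]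
    refine hQ.map_eq_of_sub_eq t' (P.π.app A) ?_
    rw [← cancel_epi (P.π.app A), reassoc_of% ht', Preadditive.comp_sub, reassoc_of% hw, hz]
    simp
  · rw [← Q.map_comp, ← Q.map_id]
    refine hQ.map_eq_of_sub_eq t p ?_
    rw [← cancel_epi p, reassoc_of% ht, Preadditive.comp_sub, reassoc_of% hz, hw]
    simp

variable {F : K ⥤ K} (i : P.S ⋙ Q ≅ Q ⋙ F)

include i

lemma additive_of_iso : F.Additive where
  map_add {X Y f g} := by
    have := hQ.additive
    have := hQ.full
    obtain ⟨A, rfl⟩ := hQ.obj_surjective X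
    obtain ⟨B, rfl⟩ := hQ.obj_surjective Y
    obtain ⟨f, rfl⟩ := Q.map_surjective f
    obtain ⟨g, rfl⟩ := Q.map_surjective g
    rw [← Q.map_add, map_map_eq i, map_map_eq i, map_map_eq i, hQ.map_S_add]
    simp

lemma isEquivalence_of_iso : F.IsEquivalence where
  faithful :=
    { map_injective := fun {X Y f g} h => by
        have := hQ.additive
        have := hQ.full
        have := hQ.additive_of_iso i
        rw [← sub_eq_zero, ← F.map_sub] at h
        rw [← sub_eq_zero]
        obtain ⟨A, rfl⟩ := hQ.obj_surjective X
        obtain ⟨B, rfl⟩ := hQ.obj_surjective Y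
        obtain ⟨k, hk⟩ := Q.map_surjective (f - g)
        rw [← hk, map_map_eq i, Preadditive.IsIso.comp_left_eq_zero,
          Preadditive.IsIso.comp_right_eq_zero, hQ.map_S_eq_zero_iff] at h
        rw [← hk, h] }
  full :=
    { map_surjective := fun {X Y} g => by
        have := hQ.full
        obtain ⟨A, rfl⟩ := hQ.obj_surjective X
        obtain ⟨B, rfl⟩ := hQ.obj_surjective Y
        obtain ⟨g', hg'⟩ := Q.map_surjective (i.hom.app A ≫ g ≫ i.inv.app B)
        obtain ⟨f, hf⟩ := hQ.exists_map_S_eq g'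
        refine ⟨Q.map f, ?_⟩
        rw [map_map_eq i, hf, hg']
        simp }
  essSurj :=
    { mem_essImage := fun Z => by
        obtain ⟨Z, rfl⟩ := hQ.obj_surjective Z
        obtain ⟨A, ⟨a⟩⟩ := hQ.exists_iso_S Z
        exact ⟨Q.obj A, ⟨(i.app A).symm ≪≫ a⟩⟩ }

omit i

/-! #### Morphisms between cones -/

/-- The cone of the identity is sent to zero. -/
lemma isZero_cone_id (X : C) : IsZero (Q.obj (P.cone (𝟙 X))) := by
  rw [IsZero.iff_id_eq_zero, ← Q.map_id]
  obtain ⟨r, hr₁, hr₂⟩ := P.exists_cone_desc (𝟙 X) (P.ι.app X) (𝟙 (P.I.obj X)) (by simp)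
  have : r ≫ P.j (𝟙 X) = 𝟙 _ := P.cone_hom_ext
    (by rw [reassoc_of% hr₁, P.ι_j]; simp) (by rw [reassoc_of% hr₂]; simp)
  rw [← this]
  exact hQ.map_comp_eq_zero _ _

/-- The homotopy `h` that makes the square commute corrects the map on `I Y` by `h ≫ u f'`. The
correction dies under `v f'`, so both squares with the cones commute already in `C`. -/
lemma exists_cone_map {X Y X' Y' : C} (f : Y ⟶ X) (f' : Y' ⟶ X') (a : Y ⟶ Y') (b : X ⟶ X')
    (w : Q.map f ≫ Q.map b = Q.map a ≫ Q.map f') :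
    ∃ c : P.cone f ⟶ P.cone f', P.u f ≫ c = b ≫ P.u f' ∧ c ≫ P.v f' = P.v f ≫ P.S.map a := by
  have := hQ.additive
  rw [← sub_eq_zero, ← Q.map_comp, ← Q.map_comp, ← Q.map_sub] at w
  obtain ⟨h, hh⟩ := (hQ.map_eq_zero_iff _).1 w
  obtain ⟨c, hc₁, hc₂⟩ := P.exists_cone_desc f (b ≫ P.u f')
    (P.I.map a ≫ P.j f' + h ≫ P.u f') (by
      rw [Preadditive.comp_add, ← Category.assoc, P.ι_naturality, Category.assoc, P.ι_j,
        reassoc_of% hh]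
      simp)
  exact ⟨c, hc₁, P.cone_hom_ext
    (by rw [reassoc_of% hc₁, P.u_v, comp_zero, ← Category.assoc, P.u_v, zero_comp])
    (by rw [reassoc_of% hc₂, Preadditive.add_comp, Category.assoc, Category.assoc, P.u_v, P.j_v,
      comp_zero, add_zero, ← Category.assoc, P.j_v, P.π_naturality])⟩

/-- The restriction of `k` to `X` factors through `I X`, and `X ⟶ I X` extends to the cone.
Subtracting a morphism that vanishes in the quotient makes `k` zero on `X`, so that it factors
through `v f` in `C`. -/
lemma exists_desc_v {X Y W : C} (f : Y ⟶ X) (k : P.cone f ⟶ W) (hk : Q.map (P.u f ≫ k) = 0) :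
    ∃ l, Q.map (P.v f) ≫ Q.map l = Q.map k := by
  have := hQ.additive
  obtain ⟨t, ht⟩ := (hQ.map_eq_zero_iff _).1 hk
  obtain ⟨s, hs, -⟩ := P.exists_cone_desc f (P.ι.app X) (P.I.map f) (P.ι_naturality f)
  have h₀ : P.u f ≫ (k - s ≫ t) = 0 := by
    rw [Preadditive.comp_sub, reassoc_of% hs, ht, sub_self]
  obtain ⟨l, hl⟩ := P.exists_desc (P.j f ≫ (k - s ≫ t)) (by
    rw [← Category.assoc, P.ι_j, Category.assoc, h₀, comp_zero])
  have hvl : P.v f ≫ l = k - s ≫ t := P.cone_hom_ext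
    (by rw [h₀, ← Category.assoc, P.u_v, zero_comp]) (by rw [← hl, ← Category.assoc, P.j_v])
  exact ⟨l, by rw [← Q.map_comp, hvl, Q.map_sub, hQ.map_comp_eq_zero, sub_zero]⟩

/-- The cone of `u f` is isomorphic to the suspension in the quotient. -/
lemma exists_iso_cone_u {X Y : C} (f : Y ⟶ X) :
    ∃ θ : Q.obj (P.S.obj Y) ≅ Q.obj (P.cone (P.u f)),
      Q.map (P.v f) ≫ θ.hom = Q.map (P.u (P.u f)) ∧
      θ.hom ≫ Q.map (P.v (P.u f)) = -Q.map (P.S.map f) := by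
  have := hQ.additive
  obtain ⟨φ, hφ₁, hφ₂⟩ := P.exists_cone_desc (P.u f) (P.v f) (0 : P.I.obj X ⟶ _)
    (by rw [comp_zero, P.u_v])
  obtain ⟨k, hk₁, hk₂⟩ := P.exists_cone_desc f (P.ι.app X) (P.I.map f) (P.ι_naturality f)
  obtain ⟨k', hk'₁, hk'₂⟩ := P.exists_cone_desc (P.u f) k (𝟙 (P.I.obj X)) (by
    rw [hk₁, Category.comp_id])
  -- The two ways from `I Y` to the cone of `u f`, directly and through `I X`, agree on `Y`; their
  -- difference descends to `S Y`.
  obtain ⟨ψ, hψ⟩ := P.exists_desc (P.j f ≫ P.u (P.u f) - P.I.map f ≫ P.j (P.u f)) (by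
    rw [Preadditive.comp_sub, ← Category.assoc, P.ι_j, Category.assoc,
      ← Category.assoc (P.ι.app Y), P.ι_naturality, Category.assoc, P.ι_j, sub_self])
  have hψφ : ψ ≫ φ = 𝟙 _ := by
    have := P.epi_π Y
    rw [← cancel_epi (P.π.app Y), reassoc_of% hψ, Preadditive.sub_comp, Category.assoc,
      Category.assoc, hφ₁, hφ₂, P.j_v]
    simp
  have hφψ : φ ≫ ψ - 𝟙 _ = (-k') ≫ P.j (P.u f) := P.cone_hom_ext (P.cone_hom_ext
      (by
        have := P.ι_j (P.u f)
        simp only [Preadditive.comp_sub, Preadditive.neg_comp, Preadditive.comp_neg,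
          reassoc_of% hφ₁, reassoc_of% hk'₁, reassoc_of% hk₁, reassoc_of% (P.u_v f), zero_comp,
          Category.comp_id, this, zero_sub])
      (by
        simp only [Preadditive.comp_sub, Preadditive.neg_comp, Preadditive.comp_neg,
          reassoc_of% hφ₁, reassoc_of% hk'₁, reassoc_of% hk₂, reassoc_of% (P.j_v f), hψ,
          Category.comp_id]
        abel))
    (by simp [reassoc_of% hφ₂, reassoc_of% hk'₂])
  -- The source of the sign in the rotation: `k'` is `I f` on `I Y` and the identity on `I X`, so
  -- followed by `π` it is the sum of `φ ≫ S f` and `v (u f)`, and this sum factors through `I X`.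
  have hv : P.v (P.u f) - (-(φ ≫ P.S.map f)) = k' ≫ P.π.app X := by
    rw [sub_neg_eq_add]
    refine P.cone_hom_ext (P.cone_hom_ext ?_ ?_) ?_
    · simp only [Preadditive.comp_add, P.u_v, comp_zero, reassoc_of% hφ₁, reassoc_of% hk'₁,
        reassoc_of% hk₁, P.ι_π, reassoc_of% (P.u_v f), zero_comp, add_zero]
    · simp only [Preadditive.comp_add, P.u_v, reassoc_of% hφ₁, reassoc_of% hk'₁,
        reassoc_of% hk₂, reassoc_of% (P.j_v f), P.π_naturality, zero_add]
    · simp only [Preadditive.comp_add, P.j_v, reassoc_of% hφ₂, reassoc_of% hk'₂, zero_comp,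
        add_zero]
  have hφψ' : Q.map φ ≫ Q.map ψ = 𝟙 _ := by
    rw [← Q.map_comp, ← Q.map_id]
    exact hQ.map_eq_of_sub_eq _ _ hφψ
  have hψφ' : Q.map ψ ≫ Q.map φ = 𝟙 _ := by rw [← Q.map_comp, hψφ, Q.map_id]
  have hv' : Q.map (P.v (P.u f)) = -(Q.map φ ≫ Q.map (P.S.map f)) := by
    rw [← Q.map_comp, ← Q.map_neg]
    exact hQ.map_eq_of_sub_eq _ _ hv
  refine ⟨⟨Q.map ψ, Q.map φ, hψφ', hφψ'⟩, ?_, ?_⟩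
  · dsimp only
    rw [← hφ₁, Q.map_comp, Category.assoc, hφψ', Category.comp_id]
  · dsimp only
    rw [hv', Preadditive.comp_neg, reassoc_of% hψφ']

/-- The cones of two morphisms and of their composite are related by the cone of a morphism. -/
lemma exists_octahedron {X₁ X₂ X₃ : C} (f : X₁ ⟶ X₂) (g : X₂ ⟶ X₃) :
    ∃ (m₁ : P.cone f ⟶ P.cone (f ≫ g)) (m₃ : P.cone (f ≫ g) ⟶ P.cone g)
      (χ : Q.obj (P.cone g) ≅ Q.obj (P.cone m₁)),
      P.u f ≫ m₁ = g ≫ P.u (f ≫ g) ∧ m₁ ≫ P.v (f ≫ g) = P.v f ∧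
      P.u (f ≫ g) ≫ m₃ = P.u g ∧ P.v (f ≫ g) ≫ P.S.map f = m₃ ≫ P.v g ∧
      Q.map m₃ ≫ χ.hom = Q.map (P.u m₁) ∧
      χ.hom ≫ Q.map (P.v m₁) = Q.map (P.v g) ≫ Q.map (P.S.map (P.u f)) := by
  obtain ⟨m₁, h₁u, h₁j⟩ := P.exists_cone_desc f (g ≫ P.u (f ≫ g)) (P.j (f ≫ g)) (by
    rw [P.ι_j, Category.assoc])
  obtain ⟨m₃, h₃u, h₃j⟩ := P.exists_cone_desc (f ≫ g) (P.u g) (P.I.map f ≫ P.j g) (by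
    rw [← Category.assoc, P.ι_naturality, Category.assoc, P.ι_j, Category.assoc])
  have hι := P.ι_j m₁
  obtain ⟨χ, hχu, hχj⟩ := P.exists_cone_desc g (P.u (f ≫ g) ≫ P.u m₁)
    (P.I.map (P.u f) ≫ P.j m₁) (by
      rw [← Category.assoc, P.ι_naturality, Category.assoc, hι, reassoc_of% h₁u])
  obtain ⟨k, hku, hkj⟩ := P.exists_cone_desc f (P.ι.app X₂) (P.I.map f) (P.ι_naturality f)
  obtain ⟨k', hk'⟩ := P.injective k
  -- The composite is not zero in `C` but factors through `I X₂`. Extending `k` to `I (cone f)` by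
  -- injectivity gives the contraction needed to define `θ` on the cone of `m₁`.
  have hm : m₁ ≫ m₃ = k ≫ P.j g := P.cone_hom_ext
    (by rw [reassoc_of% h₁u, h₃u, reassoc_of% hku, P.ι_j])
    (by rw [reassoc_of% h₁j, h₃j, reassoc_of% hkj])
  obtain ⟨θ, hθu, hθj⟩ := P.exists_cone_desc m₁ m₃ (k' ≫ P.j g) (by rw [reassoc_of% hk', hm])
  obtain ⟨q, hqu, hqj⟩ := P.exists_cone_desc (f ≫ g) (0 : X₃ ⟶ P.I.obj (P.cone f))
    (P.I.map (f ≫ P.u f) - P.j f ≫ P.ι.app _) (by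
      rw [Preadditive.comp_sub, P.ι_naturality, ← Category.assoc, P.ι_j, sub_self, comp_zero])
  have hm₃χ : m₃ ≫ χ - P.u m₁ = q ≫ P.j m₁ := P.cone_hom_ext
    (by rw [Preadditive.comp_sub, reassoc_of% h₃u, hχu, sub_self, reassoc_of% hqu, zero_comp])
    (by rw [Preadditive.comp_sub, reassoc_of% h₃j, hχj, reassoc_of% hqj, Preadditive.sub_comp,
      Category.assoc, hι, reassoc_of% h₁j, P.I.map_comp, Category.assoc])
  obtain ⟨d, hdu, hdj⟩ := P.exists_cone_desc g (0 : X₃ ⟶ P.I.obj X₂)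
    (P.I.map (P.u f) ≫ k' - 𝟙 _) (by
      rw [Preadditive.comp_sub, ← Category.assoc, P.ι_naturality, Category.assoc, hk', hku,
        Category.comp_id, sub_self, comp_zero])
  have hχθ : χ ≫ θ - 𝟙 _ = d ≫ P.j g := P.cone_hom_ext
    (by rw [Preadditive.comp_sub, reassoc_of% hχu, hθu, h₃u, Category.comp_id, sub_self,
      reassoc_of% hdu, zero_comp])
    (by rw [Preadditive.comp_sub, reassoc_of% hχj, hθj, reassoc_of% hdj]; simp)
  -- The maps `q`, `d` and `q'` are explicit homotopies: they make `m₃ ≫ χ - u m₁`, `χ ≫ θ - 1` and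
  -- `θ ≫ χ - 1` factor through objects `I _`.
  obtain ⟨q', hq'u, hq'j⟩ := P.exists_cone_desc m₁ q (k' ≫ P.I.map (P.u f) - 𝟙 _) (by
    rw [Preadditive.comp_sub, reassoc_of% hk']
    refine P.cone_hom_ext ?_ ?_
    · rw [Preadditive.comp_sub, reassoc_of% hku, P.ι_naturality, Category.comp_id, sub_self,
        reassoc_of% h₁u, hqu, comp_zero]
    · rw [Preadditive.comp_sub, reassoc_of% hkj, Category.comp_id, reassoc_of% h₁j, hqj,
        P.I.map_comp])
  have hθχ : θ ≫ χ - 𝟙 _ = q' ≫ P.j m₁ := P.cone_hom_ext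
    (by rw [Preadditive.comp_sub, reassoc_of% hθu, Category.comp_id, hm₃χ, reassoc_of% hq'u])
    (by rw [Preadditive.comp_sub, reassoc_of% hθj, hχj, reassoc_of% hq'j]; simp)
  refine ⟨m₁, m₃, ⟨Q.map χ, Q.map θ, ?_, ?_⟩, h₁u, ?_, h₃u, ?_, ?_, ?_⟩
  · rw [← Q.map_comp, ← Q.map_id]
    exact hQ.map_eq_of_sub_eq _ _ hχθ
  · rw [← Q.map_comp, ← Q.map_id]
    exact hQ.map_eq_of_sub_eq _ _ hθχ
  · exact P.cone_hom_ext (by rw [reassoc_of% h₁u, P.u_v, P.u_v, comp_zero])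
      (by rw [reassoc_of% h₁j, P.j_v, P.j_v])
  · exact P.cone_hom_ext (by rw [reassoc_of% h₃u, P.u_v, ← Category.assoc, P.u_v, zero_comp])
      (by rw [reassoc_of% h₃j, P.j_v, ← Category.assoc, P.j_v, P.π_naturality])
  · rw [← Q.map_comp]
    exact hQ.map_eq_of_sub_eq _ _ hm₃χ
  · rw [← Q.map_comp, ← Q.map_comp]
    congr 1
    exact P.cone_hom_ext (by rw [reassoc_of% hχu, P.u_v, ← Category.assoc, P.u_v]; simp)
      (by rw [reassoc_of% hχj, P.j_v, ← Category.assoc, P.j_v, P.π_naturality])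

end IsStableQuotient

/-! #### Distinguished triangles -/

section Triangles

open Pretriangulated

variable [HasShift K ℤ] (e : P.S ⋙ Q ≅ Q ⋙ shiftFunctor K (1 : ℤ))

/-- The triangle `Y ⟶ X ⟶ cone f ⟶ Y⟦1⟧`. -/
def triangle {X Y : C} (f : Y ⟶ X) : Triangle K :=
  Triangle.mk (Q.map f) (Q.map (P.u f)) (Q.map (P.v f) ≫ e.hom.app Y)

/-- The triangles which are isomorphic to the triangle given by a cone. -/
def distinguished : Set (Triangle K) :=
  { T | ∃ (X Y : C) (f : Y ⟶ X), Nonempty (T ≅ triangle e f) }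

/-- The identification of the image of the suspension with the shift. -/
def shiftIso (A : C) : Q.obj (P.S.obj A) ≅ (Q.obj A)⟦(1 : ℤ)⟧ := e.app A

lemma shiftIso_naturality {A B : C} (f : A ⟶ B) :
    (shiftIso e A).hom ≫ (Q.map f)⟦(1 : ℤ)⟧' = Q.map (P.S.map f) ≫ (shiftIso e B).hom :=
  (e.hom.naturality f).symm

lemma mem_distinguished_iff (T : Triangle K) : T ∈ distinguished e ↔
    ∃ (X Y : C) (f : Y ⟶ X) (a : T.obj₁ ≅ Q.obj Y) (b : T.obj₂ ≅ Q.obj X)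
      (c : T.obj₃ ≅ Q.obj (P.cone f)), T.mor₁ ≫ b.hom = a.hom ≫ Q.map f ∧
      T.mor₂ ≫ c.hom = b.hom ≫ Q.map (P.u f) ∧
      T.mor₃ ≫ a.hom⟦(1 : ℤ)⟧' = c.hom ≫ Q.map (P.v f) ≫ (shiftIso e Y).hom := by
  constructor
  · rintro ⟨X, Y, f, ⟨i⟩⟩
    exact ⟨X, Y, f, Triangle.π₁.mapIso i, Triangle.π₂.mapIso i, Triangle.π₃.mapIso i,
      i.hom.comm₁, i.hom.comm₂, i.hom.comm₃⟩
  · rintro ⟨X, Y, f, a, b, c, h₁, h₂, h₃⟩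
    exact ⟨X, Y, f, ⟨Triangle.isoMk _ _ a b c h₁ h₂ h₃⟩⟩

lemma triangle_mem {X Y : C} (f : Y ⟶ X) :
    Triangle.mk (Q.map f) (Q.map (P.u f)) (Q.map (P.v f) ≫ (shiftIso e Y).hom) ∈
      distinguished e :=
  ⟨X, Y, f, ⟨Iso.refl _⟩⟩

lemma distinguished_of_iso {T T' : Triangle K} (h : T ∈ distinguished e) (i : T' ≅ T) :
    T' ∈ distinguished e := by
  obtain ⟨X, Y, f, ⟨i'⟩⟩ := h
  exact ⟨X, Y, f, ⟨i ≪≫ i'⟩⟩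

namespace IsStableQuotient

variable [Preadditive K] (hQ : P.IsStableQuotient Q)

include hQ

lemma contractible_mem [HasZeroObject K] (X : K) : contractibleTriangle X ∈ distinguished e := by
  obtain ⟨X, rfl⟩ := hQ.obj_surjective X
  have h := hQ.isZero_cone_id X
  refine (mem_distinguished_iff e _).2 ⟨X, X, 𝟙 X, Iso.refl _, Iso.refl _, (isZero_zero K).iso h,
    ?_, h.eq_of_tgt _ _, (isZero_zero K).eq_of_src _ _⟩
  rw [Q.map_id]
  rfl

lemma exists_distinguished {X Y : K} (f : X ⟶ Y) :
    ∃ (Z : K) (g : Y ⟶ Z) (h : Z ⟶ X⟦(1 : ℤ)⟧), Triangle.mk f g h ∈ distinguished e := by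
  have := hQ.full
  obtain ⟨X, rfl⟩ := hQ.obj_surjective X
  obtain ⟨Y, rfl⟩ := hQ.obj_surjective Y
  obtain ⟨f, rfl⟩ := Q.map_surjective f
  exact ⟨_, _, _, triangle_mem e f⟩

lemma exists_hom {T T' : Triangle K} (hT : T ∈ distinguished e) (hT' : T' ∈ distinguished e)
    (x : T.obj₁ ⟶ T'.obj₁) (y : T.obj₂ ⟶ T'.obj₂) (w : T.mor₁ ≫ y = x ≫ T'.mor₁) :
    ∃ z : T.obj₃ ⟶ T'.obj₃, T.mor₂ ≫ z = y ≫ T'.mor₂ ∧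
      T.mor₃ ≫ x⟦(1 : ℤ)⟧' = z ≫ T'.mor₃ := by
  have := hQ.full
  obtain ⟨X, Y, f, a, b, c, h₁, h₂, h₃⟩ := (mem_distinguished_iff e T).1 hT
  obtain ⟨X', Y', f', a', b', c', h₁', h₂', h₃'⟩ := (mem_distinguished_iff e T').1 hT'
  obtain ⟨x', hx'⟩ := Q.map_surjective (a.inv ≫ x ≫ a'.hom)
  obtain ⟨y', hy'⟩ := Q.map_surjective (b.inv ≫ y ≫ b'.hom)
  obtain ⟨z', hz'₁, hz'₂⟩ := hQ.exists_cone_map f f' x' y' (by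
    rw [hx', hy', Category.assoc, Category.assoc, ← h₁', ← reassoc_of% w, ← cancel_epi a.hom,
      ← reassoc_of% h₁]
    simp)
  refine ⟨c.hom ≫ Q.map z' ≫ c'.inv, ?_, ?_⟩
  · rw [reassoc_of% h₂, ← Q.map_comp_assoc, hz'₁, Q.map_comp_assoc, hy', ← cancel_mono c'.hom]
    simp [h₂']
  · have hx : x = a.hom ≫ Q.map x' ≫ a'.inv := by simp [hx']
    have h₃'' : c'.inv ≫ T'.mor₃ = Q.map (P.v f') ≫ (shiftIso e Y').hom ≫ a'.inv⟦(1 : ℤ)⟧' := by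
      rw [Iso.inv_comp_eq, ← Category.assoc (Q.map _), ← Category.assoc c'.hom, ← h₃',
        Category.assoc, ← Functor.map_comp, a'.hom_inv_id, CategoryTheory.Functor.map_id, Category.comp_id]
    rw [hx, Functor.map_comp, Functor.map_comp, reassoc_of% h₃, Category.assoc, Category.assoc,
      h₃'', ← Q.map_comp_assoc, hz'₂, Q.map_comp_assoc, ← Category.assoc (shiftIso e Y).hom,
      shiftIso_naturality, Category.assoc]

lemma exists_desc {T : Triangle K} (hT : T ∈ distinguished e) {W : K} (k : T.obj₃ ⟶ W)
    (hk : T.mor₂ ≫ k = 0) : ∃ l, T.mor₃ ≫ l = k := by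
  have := hQ.full
  obtain ⟨X, Y, f, a, b, c, h₁, h₂, h₃⟩ := (mem_distinguished_iff e T).1 hT
  obtain ⟨W, rfl⟩ := hQ.obj_surjective W
  obtain ⟨k', hk'⟩ := Q.map_surjective (c.inv ≫ k)
  obtain ⟨l, hl⟩ := hQ.exists_desc_v f k' (by
    rw [Q.map_comp, hk', ← cancel_epi b.hom, ← reassoc_of% h₂, c.hom_inv_id_assoc, hk, comp_zero])
  refine ⟨a.hom⟦(1 : ℤ)⟧' ≫ (shiftIso e Y).inv ≫ Q.map l, ?_⟩
  rw [reassoc_of% h₃, Iso.hom_inv_id_assoc, hl, hk', c.hom_inv_id_assoc]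

lemma rotate_mem {T : Triangle K} (hT : T ∈ distinguished e) : T.rotate ∈ distinguished e := by
  obtain ⟨X, Y, f, a, b, c, h₁, h₂, h₃⟩ := (mem_distinguished_iff e T).1 hT
  obtain ⟨θ, hθ₁, hθ₂⟩ := hQ.exists_iso_cone_u f
  have h₃' : T.mor₃ ≫ (a.hom⟦(1 : ℤ)⟧' ≫ (shiftIso e Y).inv ≫ θ.hom) =
      c.hom ≫ Q.map (P.u (P.u f)) := by
    rw [reassoc_of% h₃, Iso.hom_inv_id_assoc, hθ₁]
  have h₁' : (-T.mor₁⟦(1 : ℤ)⟧') ≫ b.hom⟦(1 : ℤ)⟧' =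
      (a.hom⟦(1 : ℤ)⟧' ≫ (shiftIso e Y).inv ≫ θ.hom) ≫
        Q.map (P.v (P.u f)) ≫ (shiftIso e X).hom := by
    rw [Preadditive.neg_comp, ← Functor.map_comp, h₁, Category.assoc, Category.assoc,
      reassoc_of% hθ₂, Preadditive.neg_comp, ← shiftIso_naturality, Preadditive.comp_neg,
      Iso.inv_hom_id_assoc, Preadditive.comp_neg, Functor.map_comp]
  exact (mem_distinguished_iff e _).2 ⟨_, _, P.u f, b, c,
    (shiftFunctor K (1 : ℤ)).mapIso a ≪≫ (shiftIso e Y).symm ≪≫ θ, h₂, h₃', h₁'⟩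

/-- For an endomorphism `c` of one triangle, `c - 1` kills `g`, hence factors through `h`; as `(c -
1) ≫ h = 0`, its square vanishes and `1 - (c - 1)` is an inverse. The general case applies this to
`c ≫ c'` and `c' ≫ c`, with `c'` a completion in the other direction. No long exact sequence is
needed. -/
lemma isIso_of_distinguished {X Y Z Z' : K} {f : X ⟶ Y} {g : Y ⟶ Z} {h : Z ⟶ X⟦(1 : ℤ)⟧}
    {g' : Y ⟶ Z'} {h' : Z' ⟶ X⟦(1 : ℤ)⟧} (hT : Triangle.mk f g h ∈ distinguished e)
    (hT' : Triangle.mk f g' h' ∈ distinguished e) (c : Z ⟶ Z') (hg : g ≫ c = g')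
    (hh : c ≫ h' = h) : IsIso c := by
  have key : ∀ {Z : K} {g : Y ⟶ Z} {h : Z ⟶ X⟦(1 : ℤ)⟧},
      Triangle.mk f g h ∈ distinguished e → ∀ c : Z ⟶ Z, g ≫ c = g → c ≫ h = h → IsIso c := by
    intro Z g h hT c hg hh
    obtain ⟨l, hl⟩ : ∃ l, h ≫ l = c - 𝟙 _ := hQ.exists_desc e hT (c - 𝟙 Z) (by
      change g ≫ (c - 𝟙 Z) = 0
      rw [Preadditive.comp_sub, hg, Category.comp_id, sub_self])
    have h₀ : (c - 𝟙 _) ≫ (c - 𝟙 _) = 0 := by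
      nth_rw 2 [← hl]
      rw [← Category.assoc, Preadditive.sub_comp, hh, Category.id_comp, sub_self, zero_comp]
    refine ⟨𝟙 _ - (c - 𝟙 _), ?_, ?_⟩
    · simp only [Preadditive.comp_sub, Preadditive.sub_comp, Category.id_comp,
        Category.comp_id] at h₀ ⊢
      rw [← sub_eq_zero, ← neg_eq_zero, ← h₀]
      abel
    · simp only [Preadditive.comp_sub, Preadditive.sub_comp, Category.id_comp,
        Category.comp_id] at h₀ ⊢
      rw [← sub_eq_zero, ← neg_eq_zero, ← h₀]
      abel
  obtain ⟨c', hc'₁, hc'₂⟩ : ∃ c' : Z' ⟶ Z, g' ≫ c' = 𝟙 _ ≫ g ∧ h' ≫ (𝟙 X)⟦(1 : ℤ)⟧' = c' ≫ h :=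
    hQ.exists_hom e hT' hT (𝟙 X) (𝟙 Y) ((Category.comp_id _).trans (Category.id_comp _).symm)
  rw [Category.id_comp] at hc'₁
  rw [CategoryTheory.Functor.map_id, Category.comp_id] at hc'₂
  have i₁ := key hT (c ≫ c') (by rw [reassoc_of% hg, hc'₁]) (by rw [Category.assoc, ← hc'₂, hh])
  have i₂ := key hT' (c' ≫ c) (by rw [reassoc_of% hc'₁, hg]) (by rw [Category.assoc, hh, hc'₂])
  have e₁ : c ≫ c' ≫ inv (c ≫ c') = 𝟙 _ := by rw [← Category.assoc, IsIso.hom_inv_id]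
  have e₂ : (inv (c' ≫ c) ≫ c') ≫ c = 𝟙 _ := by rw [Category.assoc, IsIso.inv_hom_id]
  have : IsSplitMono c := ⟨⟨⟨_, e₁⟩⟩⟩
  have : Epi c := (⟨⟨⟨_, e₂⟩⟩⟩ : IsSplitEpi c).epi
  exact isIso_of_epi_of_isSplitMono c

/-- Compare `T` with a distinguished triangle on its first morphism. After three rotations of each,
both are distinguished with the same first morphism, so their third objects are isomorphic
compatibly; the shift is an equivalence, so this isomorphism descends to one of the original
triangles. -/
lemma mem_of_rotate_mem {T : Triangle K} (hT : T.rotate ∈ distinguished e) :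
    T ∈ distinguished e := by
  obtain ⟨Z', g', h', hT'⟩ := hQ.exists_distinguished e T.mor₁
  have h₃ := hQ.rotate_mem e (hQ.rotate_mem e hT)
  have h₃' := hQ.rotate_mem e (hQ.rotate_mem e (hQ.rotate_mem e hT'))
  replace h₃ : Triangle.mk (-T.mor₁⟦(1 : ℤ)⟧') (-T.mor₂⟦(1 : ℤ)⟧') (-T.mor₃⟦(1 : ℤ)⟧') ∈
    distinguished e := h₃
  replace h₃' : Triangle.mk (-T.mor₁⟦(1 : ℤ)⟧') (-g'⟦(1 : ℤ)⟧') (-h'⟦(1 : ℤ)⟧') ∈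
    distinguished e := h₃'
  obtain ⟨d, hd₁, hd₂⟩ : ∃ d : T.obj₃⟦(1 : ℤ)⟧ ⟶ Z'⟦(1 : ℤ)⟧,
      (-T.mor₂⟦(1 : ℤ)⟧') ≫ d = 𝟙 _ ≫ (-g'⟦(1 : ℤ)⟧') ∧
      (-T.mor₃⟦(1 : ℤ)⟧') ≫ (𝟙 (T.obj₁⟦(1 : ℤ)⟧))⟦(1 : ℤ)⟧' = d ≫ (-h'⟦(1 : ℤ)⟧') :=
    hQ.exists_hom e h₃ h₃' (𝟙 (T.obj₁⟦(1 : ℤ)⟧)) (𝟙 (T.obj₂⟦(1 : ℤ)⟧))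
      ((Category.comp_id _).trans (Category.id_comp _).symm)
  rw [Category.id_comp] at hd₁
  rw [CategoryTheory.Functor.map_id, Category.comp_id] at hd₂
  have hd : IsIso d := hQ.isIso_of_distinguished e h₃ h₃' d hd₁ hd₂.symm
  obtain ⟨c, hc⟩ : ∃ c : T.obj₃ ⟶ Z', c⟦(1 : ℤ)⟧' = d :=
    (shiftFunctor K (1 : ℤ)).map_surjective d
  rw [Preadditive.neg_comp, neg_inj, ← hc, ← Functor.map_comp] at hd₁
  rw [Preadditive.comp_neg, neg_inj, ← hc, ← Functor.map_comp] at hd₂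
  have hc₁ := (shiftFunctor K (1 : ℤ)).map_injective hd₁
  have hc₂ := (shiftFunctor K (1 : ℤ)).map_injective hd₂
  have : IsIso (c⟦(1 : ℤ)⟧') := by rw [hc]; exact hd
  have : IsIso c := isIso_of_reflects_iso c (shiftFunctor K (1 : ℤ))
  let i : T.obj₃ ≅ Z' := asIso c
  refine distinguished_of_iso e hT' (Triangle.isoMk _ _ (Iso.refl _) (Iso.refl _) i
    ((Category.comp_id _).trans (Category.id_comp _).symm)
    (hc₁.trans (Category.id_comp _).symm) ?_)
  change T.mor₃ ≫ (𝟙 T.obj₁)⟦(1 : ℤ)⟧' = c ≫ h'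
  rw [CategoryTheory.Functor.map_id, Category.comp_id, hc₂]

variable [∀ n : ℤ, (shiftFunctor K n).Additive]

/-- The pretriangulated structure on a stable quotient. -/
abbrev pretriangulated [HasZeroObject K] : Pretriangulated K where
  distinguishedTriangles := distinguished e
  isomorphic_distinguished _ hT _ i := distinguished_of_iso e hT i
  contractible_distinguished X := hQ.contractible_mem e X
  distinguished_cocone_triangle f := hQ.exists_distinguished e f
  rotate_distinguished_triangle _ := ⟨hQ.rotate_mem e, hQ.mem_of_rotate_mem e⟩
  complete_distinguished_triangle_morphism _ _ hT hT' x y w := hQ.exists_hom e hT hT' x y w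

/-- It suffices to find one octahedron for each composable pair. Lifting the pair to `C` and using
the cones of `f`, `g` and `f ≫ g`, the required triangle is the cone triangle of `m₁`, with third
object identified by `χ`. -/
lemma isTriangulated [HasZeroObject K] :
    letI := hQ.pretriangulated e
    IsTriangulated K := by
  let := hQ.pretriangulated e
  have := hQ.full
  refine IsTriangulated.mk' fun X₁ X₂ X₃ f g => ?_
  obtain ⟨X₁, rfl⟩ := hQ.obj_surjective X₁
  obtain ⟨X₂, rfl⟩ := hQ.obj_surjective X₂
  obtain ⟨X₃, rfl⟩ := hQ.obj_surjective X₃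
  obtain ⟨f, rfl⟩ := Q.map_surjective f
  obtain ⟨g, rfl⟩ := Q.map_surjective g
  obtain ⟨m₁, m₃, χ, h₁, h₂, h₃, h₄, h₅, h₆⟩ := hQ.exists_octahedron f g
  have hfg := triangle_mem e (f ≫ g)
  rw [Q.map_comp f g] at hfg
  refine ⟨_, _, _, _, _, _, Q.map f, Q.map g, Iso.refl _, Iso.refl _, Iso.refl _, by simp, by simp,
    _, _, triangle_mem e f, _, _, triangle_mem e g, _, _, hfg, ⟨?_⟩⟩
  exact
    { m₁ := Q.map m₁
      m₃ := Q.map m₃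
      comm₁ := by rw [← Q.map_comp, h₁, Q.map_comp]
      comm₂ := by rw [← Category.assoc, ← Q.map_comp, h₂]
      comm₃ := by rw [← Q.map_comp, h₃]
      comm₄ := by
        rw [Category.assoc, shiftIso_naturality, ← Q.map_comp_assoc, h₄, Q.map_comp_assoc]
      mem := by
        have w : ((Q.map (P.v g) ≫ (shiftIso e X₂).hom) ≫ (Q.map (P.u f))⟦(1 : ℤ)⟧') ≫
            (𝟙 (Q.obj (P.cone f)))⟦(1 : ℤ)⟧' =
            χ.hom ≫ Q.map (P.v m₁) ≫ (shiftIso e _).hom := by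
          rw [CategoryTheory.Functor.map_id, Category.comp_id, reassoc_of% h₆, Category.assoc,
            shiftIso_naturality]
        exact (mem_distinguished_iff e _).2 ⟨_, _, m₁, Iso.refl _, Iso.refl _, χ,
          (Category.comp_id _).trans (Category.id_comp _).symm,
          h₅.trans (Category.id_comp _).symm, w⟩ }

end IsStableQuotient

end Triangles

end ConeSystem

/-! ### The homotopy category of `N`-complexes -/

namespace NComplex

variable (B : Type u) [Category.{v} B] [Preadditive B] [HasFiniteBiproducts B] {N : ℕ} (hN : 2 ≤ N)

lemma coneFromId_coneSnd {X Y : NComplex B N} (f : Y ⟶ X) :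
    coneFromId f ≫ coneSnd f = coneSnd (𝟙 Y) := by
  rw [coneFromId, coneMap_coneSnd, CategoryTheory.Functor.map_id]
  exact Category.comp_id _

variable (N) in
/-- The inclusion of an `N`-complex in the cone of its identity. -/
def coneIdIncl : 𝟭 (NComplex B N) ⟶ coneIdFunctor B N where
  app Y := coneInl (𝟙 Y)
  naturality _ _ a := (coneInl_coneMap (𝟙 _) (𝟙 _) a a (by simp)).symm

variable (N) in
/-- The projection of the cone of the identity to the suspension. -/
def coneIdProj : coneIdFunctor B N ⟶ suspFunctor B N where
  app Y := coneSnd (𝟙 Y)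
  naturality _ _ a := coneMap_coneSnd (𝟙 _) (𝟙 _) a a (by simp)

/-- The mapping cones of morphisms of `N`-complexes. -/
def coneSystem : ConeSystem (NComplex B N) where
  I := coneIdFunctor B N
  S := suspFunctor B N
  ι := coneIdIncl B N
  π := coneIdProj B N
  mono_ι A := (termwiseSplit_cone (𝟙 A)).mono_f
  epi_π A := (termwiseSplit_cone (𝟙 A)).epi_g
  ι_π A := coneInl_coneSnd (𝟙 A)
  exists_lift {A W} h w := (termwiseSplit_cone (𝟙 A)).exists_lift h w
  exists_desc {A W} h w := (termwiseSplit_cone (𝟙 A)).exists_desc h w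
  injective {A W} g := isRelInjective_cone_id hN W _ ⟨_, _, _, termwiseSplit_cone (𝟙 A)⟩ g
  projective {A W} g := isRelProjective_cone_id hN W _ ⟨_, _, _, termwiseSplit_cone (𝟙 A)⟩ g
  exists_cover Z := by
    obtain ⟨Y, p, A, a, w, h⟩ := exists_cone_id_deflation hN Z
    exact ⟨A, Y, a, p, h.epi_g, w, fun k hk => h.exists_desc k hk,
      fun {W} g => isRelInjective_cone_id hN W a ⟨_, _, _, h⟩ g⟩
  cone := cone
  u := coneInl
  j := coneFromId
  v := coneSnd
  ι_j {Y X} f := coneInl_coneMap (𝟙 Y) f (𝟙 Y) f (by simp)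
  j_v := coneFromId_coneSnd B
  u_v := coneInl_coneSnd
  exists_cone_desc {Y X W} f g h w := exists_cone_desc f g h w
  cone_hom_ext := coneFromId_hom_ext

lemma coneSystem_isStableQuotient :
    (coneSystem B hN).IsStableQuotient (NHomotopyCategory.quotient B N) where
  additive := inferInstance
  full := inferInstanceAs (CategoryTheory.Quotient.functor _).Full
  obj_surjective X := ⟨X.as, rfl⟩
  map_eq_zero_iff f := by
    rw [← (NHomotopyCategory.quotient B N).map_zero]
    refine (CategoryTheory.Quotient.functor_map_eq_iff (homotopic B N) f 0).trans ?_
    rw [homotopic, sub_zero]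
    exact nullHomotopic_iff hN f

/-- The functor which `Σ` induces on the homotopy category. -/
def suspHomotopyFunctor : NHomotopyCategory B N ⥤ NHomotopyCategory B N :=
  CategoryTheory.Quotient.lift (homotopic B N) (suspFunctor B N ⋙ NHomotopyCategory.quotient B N)
    fun X Y f g h => by
      have hQ := coneSystem_isStableQuotient B hN
      have h₀ := (hQ.map_S_eq_zero_iff (f - g)).2
        ((hQ.map_eq_zero_iff _).2 ((nullHomotopic_iff hN _).1 h))
      have h₁ := hQ.map_S_add (f - g) g
      rw [sub_add_cancel, h₀, zero_add] at h₁
      exact h₁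

/-- The compatibility of `suspHomotopyFunctor` with `Σ`. -/
def suspHomotopyFunctorIso : suspFunctor B N ⋙ NHomotopyCategory.quotient B N ≅
    NHomotopyCategory.quotient B N ⋙ suspHomotopyFunctor B hN :=
  Iso.refl _

end NComplex

end

/-! ### The main theorem. -/

theorem mainTheorem1 {B : Type u} [Category.{v} B] [Preadditive B] [HasFiniteBiproducts B] 
    (N : ℕ) (hN : 2 ≤ N) :
    IsFrobeniusCategory (NComplex.termwiseSplit B N) ∧
    ∃ (_ : HasShift (NHomotopyCategory B N) ℤ)
      (_ : ∀ n : ℤ, (shiftFunctor (NHomotopyCategory B N) n).Additive)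
      (_ : Pretriangulated (NHomotopyCategory B N)),
      IsTriangulated (NHomotopyCategory B N) ∧
      ∃ e : NComplex.suspFunctor B N ⋙ NHomotopyCategory.quotient B N ≅
          NHomotopyCategory.quotient B N ⋙ shiftFunctor (NHomotopyCategory B N) (1 : ℤ),
        ∀ T : Pretriangulated.Triangle (NHomotopyCategory B N),
          T ∈ Pretriangulated.distinguishedTriangles ↔
            ∃ (X Y : NComplex B N) (f : Y ⟶ X), Nonempty (T ≅ NComplex.coneTriangle e f) := by
  refine ⟨NComplex.isFrobeniusCategory_termwiseSplit B hN, ?_⟩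
  have hQ := NComplex.coneSystem_isStableQuotient B hN
  have := hQ.isEquivalence_of_iso (NComplex.suspHomotopyFunctorIso B hN)
  obtain ⟨_, ⟨i⟩⟩ := exists_hasShift_of_isEquivalence (NComplex.suspHomotopyFunctor B hN)
  -- The chosen shift by one is only isomorphic to the functor induced by the suspension, so the
  -- identification `e` is part of the definition of the triangles. With this `e`, the cone
  -- triangles of the statement are by definition those of the cone system.
  let e : (NComplex.coneSystem B hN).S ⋙ NHomotopyCategory.quotient B N ≅
      NHomotopyCategory.quotient B N ⋙ shiftFunctor (NHomotopyCategory B N) (1 : ℤ) :=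
    NComplex.suspHomotopyFunctorIso B hN ≪≫
      Functor.isoWhiskerLeft (NHomotopyCategory.quotient B N) i
  have := hQ.additive_of_iso e
  have hadd : ∀ n : ℤ, (shiftFunctor (NHomotopyCategory B N) n).Additive :=
    additive_shiftFunctor_of_one
  exact ⟨inferInstance, hadd, hQ.pretriangulated e, hQ.isTriangulated e, e, fun T => Iff.rfl⟩
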